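/- Let $G$ be a regular diffeological Lie group, that is, a diffeological group such that (i) for every $\xi\in T_eG$, $\xi\ne 0$, there is a smooth linear functional $\ell$ on the internal tangent space $T_eG$ with $\ell(\xi)\neq 0$; (ii) the plots of $T_eG$ smoothly factor through a smooth map $\varphi\colon V\to T_eG$, with $V$ open in a complete Hausdorff locally convex topological vector space; (iii) for every smooth $\xi\colon[0,1]\to T_eG$ there is a unique smooth $g=\exp(\xi)\colon[0,1]\to G$ with $g(0)=e$ and $(R_{g(t)^{-1}})_*\frac{dg}{dt}(t)=\xi(t)$ for $0<t<1$, and the map $\exp\colon C^\infty([0,1],T_eG)\to C^\infty([0,1],G)$ is smooth. Let $X$ be a diffeological space whose D-topology is Hausdorff and which is smoothly paracompact: its D-topology is paracompact and every open cover has a subordinate smooth partition of unity. Let $\pi\colon E\to X$ be a principal $G$-bundle which is weakly D-numerable: there are a cover of $X$ by D-open sets $U_i$ ($i\in\mathbb N$) over which $\pi$ is trivial, and a pointwise-finite smooth partition of unity $(\zeta_i)_{i\in\mathbb N}$ on $X$ with $\zeta_i^{-1}((0,1])\subseteq U_i$ for all $i$. Then $\pi$ admits a diffeological connection in the sense of Iglesias-Zemmour: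 a map $\theta$, smooth for the functional diffeologies, that assigns to every smooth path $\gamma\colon I\to E$ on an open interval $I\subseteq\mathbb R$ and every $t_0\in I$ a smooth path $\theta(\gamma,t_0)\colon I\to E$ such that 1. $\pi\circ\theta(\gamma,t_0)=\pi\circ\gamma$; 2. $\theta(\gamma,t_0)(t_0)=\gamma(t_0)$; 3. $\theta(k\cdot\gamma,t_0)=k(t_0)\cdot\theta(\gamma,t_0)$ for every smooth $k\colon I\to G$ (in particular $\theta(g\cdot\gamma,t_0)=g\cdot\theta(\gamma,t_0)$ for every $g\in G$); 4. $\theta(\gamma\circ f,s)=\theta(\gamma,f(s))\circ f$ for every smooth map $f\colon J\to I$ from an open interval $J$ and every $s\in J$; 5. $\theta(\theta(\gamma,t_0),t_0)=\theta(\gamma,t_0)$. Moreover, $\theta$ can be chosen such that smooth curves in $X$ have unique horizontal lifts: for every smooth curve $c\colon I\to X$ on an open interval, every $t_0\in I$ and every $y\in\pi^{-1}(c(t_0))$ there is a smooth $\gamma\colon I\to E$ with $\pi\circ\gamma=c$, $\gamma(t_0)=y$ and $\theta(\gamma,t)=\gamma$ for all $t\in I$, and $\gamma$ is the only smooth lift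 of $c$ with $\gamma(t_0)=y$ and $\theta(\gamma,t_0)=\gamma$. -/

import Mathlib

open Set Filter Topology
open scoped ContDiff DirectSum
open Diffeology

noncomputable section

namespace DiffBundle

universe u v w

/-- The test spaces of diffeology. As everywhere in Mathlib, plots are defined on all of `ℝⁿ`; by
locality this is the same as allowing plots on open subsets of `ℝⁿ`. -/
abbrev Euc (n : ℕ) : Type := EuclideanSpace ℝ (Fin n)

/-! ### Subset, product and functional diffeologies -/

section Basic

variable {X : Type u} {Y : Type v} {Z : Type w}
variable [DiffeologicalSpace X] [DiffeologicalSpace Y] [DiffeologicalSpace Z]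

/-- The pullback of a diffeology along a map. -/
@[reducible]
def inducedDiffeology {A : Type u} {Y : Type v} [DiffeologicalSpace Y] (f : A → Y) :
    DiffeologicalSpace A where
  plots _ := {p | IsPlot (f ∘ p)}
  constant_plots _ := isPlot_const
  plot_reparam hp hf := isPlot_reparam hp hf
  locality := by
    intro n p h
    refine DiffeologicalSpace.locality (p := f ∘ p) fun x => ?_
    obtain ⟨s, hs, hxs, H⟩ := h x
    exact ⟨s, hs, hxs, fun hf hc => H hf hc⟩

/-- The subset diffeology. -/
instance subtypeDiffeology (s : X → Prop) : DiffeologicalSpace (Subtype s) :=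
  inducedDiffeology Subtype.val

/-- The product diffeology. -/
instance prodDiffeology : DiffeologicalSpace (X × Y) where
  plots _ := {p | IsPlot (fun z => (p z).1) ∧ IsPlot (fun z => (p z).2)}
  constant_plots _ := ⟨isPlot_const, isPlot_const⟩
  plot_reparam hp hf := ⟨isPlot_reparam hp.1 hf, isPlot_reparam hp.2 hf⟩
  locality := by
    intro n p h
    constructor
    · refine DiffeologicalSpace.locality fun x => ?_
      obtain ⟨s, hs, hxs, H⟩ := h x
      exact ⟨s, hs, hxs, fun hf hc => (H hf hc).1⟩
    · refine DiffeologicalSpace.locality fun x => ?_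
      obtain ⟨s, hs, hxs, H⟩ := h x
      exact ⟨s, hs, hxs, fun hf hc => (H hf hc).2⟩

lemma dSmooth_fst : DSmooth (Prod.fst : X × Y → X) := fun _ _ hp => hp.1

lemma dSmooth_snd : DSmooth (Prod.snd : X × Y → Y) := fun _ _ hp => hp.2

lemma dSmooth_prodMk {f : X → Y} {g : X → Z} (hf : DSmooth f) (hg : DSmooth g) :
    DSmooth (fun x => (f x, g x)) := fun n p hp => ⟨hf n p hp, hg n p hp⟩

lemma dSmooth_val (s : X → Prop) : DSmooth (Subtype.val : Subtype s → X) := fun _ _ hp => hp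

/-- The set `C^∞(X, Y)` of smooth maps. -/
@[ext]
structure SmoothMap (X : Type u) (Y : Type v) [DiffeologicalSpace X] [DiffeologicalSpace Y] where
  /-- The underlying map. -/
  toFun : X → Y
  smooth : DSmooth toFun

instance : CoeFun (SmoothMap X Y) (fun _ => X → Y) := ⟨SmoothMap.toFun⟩

/-- The standard functional diffeology on `C^∞(X, Y)`: a parametrisation `p` is a plot if and only
if `(z, x) ↦ p z x` is smooth. -/
instance smoothMapDiffeology : DiffeologicalSpace (SmoothMap X Y) where
  plots n := {p | DSmooth (fun z : Euc n × X => p z.1 z.2)}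
  constant_plots f := f.smooth.comp dSmooth_snd
  plot_reparam {n m p f} hp hf :=
    DSmooth.comp (g := fun z : Euc _ × X => p z.1 z.2) (f := fun z : Euc n × X => (f z.1, z.2)) hp
      (dSmooth_prodMk ((ContDiff.dSmooth hf).comp dSmooth_fst) dSmooth_snd)
  locality := by
    intro n p h k a ha
    refine DiffeologicalSpace.locality fun x => ?_
    obtain ⟨s, hs, hxs, H⟩ := h (a x).1
    have ha1 : ContDiff ℝ ∞ (fun z => (a z).1) := ha.1.contDiff
    refine ⟨(fun z => (a z).1) ⁻¹' s, hs.preimage ha1.continuous, hxs, ?_⟩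
    intro m f hf hc
    have h1 := H (f := fun z => (a (f z)).1) hf (ha1.comp hc)
    exact h1 m (fun z => (z, (a (f z)).2)) ⟨isPlot_id, isPlot_reparam ha.2 hc⟩

/-- Diffeomorphisms. -/
structure Diffeo (X : Type u) (Y : Type v) [DiffeologicalSpace X] [DiffeologicalSpace Y]
    extends X ≃ Y where
  smooth_toFun : DSmooth toFun
  smooth_invFun : DSmooth invFun

end Basic

/-! ### The internal tangent bundle -/

section Tangent

variable {X : Type u} {Y : Type v} [DiffeologicalSpace X] [DiffeologicalSpace Y]

/-- Plots `p : ℝⁿ → X` with `p 0 = x`. -/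
structure PointedPlot (x : X) where
  /-- The dimension of the domain. -/
  dim : ℕ
  /-- The plot. -/
  toFun : Euc dim → X
  isPlot : IsPlot toFun
  map_zero : toFun 0 = x

/-- The image of a pointed plot under a smooth map. -/
@[reducible]
def PointedPlot.map (f : SmoothMap X Y) {x : X} (p : PointedPlot x) : PointedPlot (f x) where
  dim := p.dim
  toFun := fun z => f (p.toFun z)
  isPlot := p.isPlot.dSmooth_comp f.smooth
  map_zero := by rw [p.map_zero]

open Classical in
/-- The relations `(p, v) ∼ (q, Df(0) v)` of the colimit, for every arrow `f : p → q` between plots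
pointed at `x`, that is, every smooth map `f` with `f 0 = 0` and `p = q ∘ f`. -/
def tangentRel (x : X) : Submodule ℝ (⨁ p : PointedPlot x, Euc p.dim) :=
  Submodule.span ℝ {a | ∃ (p q : PointedPlot x) (f : Euc p.dim → Euc q.dim) (v : Euc p.dim),
    ContDiff ℝ ∞ f ∧ f 0 = 0 ∧ (∀ z, p.toFun z = q.toFun (f z)) ∧
    a = DirectSum.lof ℝ (PointedPlot x) (fun p => Euc p.dim) p v
      - DirectSum.lof ℝ (PointedPlot x) (fun p => Euc p.dim) q (fderiv ℝ f 0 v)}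

/-- The internal tangent space `T_x X`: the colimit, in the category of real vector spaces, of the
spaces `T₀ℝⁿ` over the category of plots pointed at `x`, written as a quotient of a direct sum. -/
def IntTangentSpace (x : X) : Type u := (⨁ p : PointedPlot x, Euc p.dim) ⧸ tangentRel x

instance (x : X) : AddCommGroup (IntTangentSpace x) :=
  inferInstanceAs (AddCommGroup ((⨁ p : PointedPlot x, Euc p.dim) ⧸ tangentRel x))

instance (x : X) : Module ℝ (IntTangentSpace x) :=
  inferInstanceAs (Module ℝ ((⨁ p : PointedPlot x, Euc p.dim) ⧸ tangentRel x))

open Classical in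
/-- `p_* v`, for a plot `p` pointed at `x` and `v ∈ T₀ℝⁿ`. -/
def PointedPlot.push {x : X} (p : PointedPlot x) : Euc p.dim →ₗ[ℝ] IntTangentSpace x :=
  (tangentRel x).mkQ ∘ₗ DirectSum.lof ℝ (PointedPlot x) (fun p => Euc p.dim) p

/-- Arrows between pointed plots identify tangent vectors. -/
lemma PointedPlot.push_eq {x : X} (p q : PointedPlot x) (f : Euc p.dim → Euc q.dim)
    (hf : ContDiff ℝ ∞ f) (hf0 : f 0 = 0) (h : ∀ z, p.toFun z = q.toFun (f z)) (v : Euc p.dim) :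
    p.push v = q.push (fderiv ℝ f 0 v) :=
  (Submodule.Quotient.eq (tangentRel x)).2 (Submodule.subset_span ⟨p, q, f, v, hf, hf0, h, rfl⟩)

open Classical in
/-- The tangent map `T_x X → T_{f x} Y`, sending `p_* v` to `(f ∘ p)_* v`. -/
def tangentMapAt (f : SmoothMap X Y) (x : X) : IntTangentSpace x →ₗ[ℝ] IntTangentSpace (f x) :=
  (tangentRel x).liftQ
    (DirectSum.toModule ℝ (PointedPlot x) (IntTangentSpace (f x)) fun p => (p.map f).push) <| by
    refine Submodule.span_le.2 ?_
    rintro _ ⟨p, q, g, v, hg, hg0, hpq, rfl⟩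
    refine LinearMap.mem_ker.2 ((map_sub _ _ _).trans (sub_eq_zero.2 ?_))
    have key : ∀ (p : PointedPlot x) (v : Euc p.dim),
        DirectSum.toModule ℝ (PointedPlot x) (IntTangentSpace (f x)) (fun p => (p.map f).push)
          (DirectSum.lof ℝ (PointedPlot x) (fun p => Euc p.dim) p v) = (p.map f).push v :=
      fun p v => DirectSum.toModule_lof (M := fun p : PointedPlot x => Euc p.dim) ℝ p v
    refine (key p v).trans (Eq.trans ?_ (key q _).symm)
    exact PointedPlot.push_eq (p.map f) (q.map f) g hg hg0 (fun z => congrArg f (hpq z)) v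

/-- The set underlying the internal tangent bundle. -/
structure IntTangentBundle (X : Type u) [DiffeologicalSpace X] : Type u where
  /-- The foot point. -/
  base : X
  /-- The tangent vector. -/
  vec : IntTangentSpace base

/-- The tangent map `TX → TY` of a smooth map. -/
def tangentMap (f : SmoothMap X Y) (a : IntTangentBundle X) : IntTangentBundle Y :=
  ⟨f a.base, tangentMapAt f a.base a.vec⟩

/-- The induced map `Tp : Tℝⁿ → TX` of a plot, `(z, v) ↦ (p ∘ tr_z)_* v`. -/
def plotTangent {n : ℕ} (p : Euc n → X) (hp : IsPlot p) (z v : Euc n) : IntTangentBundle X :=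
  ⟨p z, PointedPlot.push (x := p z)
    ⟨n, fun y => p (z + y), isPlot_reparam hp (contDiff_const.add contDiff_id), by simp⟩ v⟩

/-- The diffeologies on `TX` for which `TX → X` is a vector pseudo-bundle and all maps `Tp` are
smooth. -/
structure IsTangentDiffeology (d : DiffeologicalSpace (IntTangentBundle X)) : Prop where
  /-- The projection is smooth. -/
  proj : ∀ (n : ℕ) (a : Euc n → IntTangentBundle X), @IsPlot _ d n a → IsPlot (fun z => (a z).base)
  /-- Fibrewise addition `TX ×_X TX → TX` is smooth. -/
  add : ∀ (n : ℕ) (x : Euc n → X) (a b : ∀ z, IntTangentSpace (x z)),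
    @IsPlot _ d n (fun z => ⟨x z, a z⟩) → @IsPlot _ d n (fun z => ⟨x z, b z⟩) →
    @IsPlot _ d n (fun z => ⟨x z, a z + b z⟩)
  /-- Scalar multiplication `ℝ × TX → TX` is smooth. -/
  smul : ∀ (n : ℕ) (r : Euc n → ℝ) (x : Euc n → X) (a : ∀ z, IntTangentSpace (x z)),
    IsPlot r → @IsPlot _ d n (fun z => ⟨x z, a z⟩) → @IsPlot _ d n (fun z => ⟨x z, r z • a z⟩)
  /-- The zero section is smooth. -/
  zero : ∀ (n : ℕ) (x : Euc n → X), IsPlot x → @IsPlot _ d n (fun z => ⟨x z, 0⟩)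
  /-- `Tp` is smooth for every plot `p`. -/
  plotTangent : ∀ (m : ℕ) (p : Euc m → X) (hp : IsPlot p) (n : ℕ) (y v : Euc n → Euc m),
    IsPlot y → IsPlot v → @IsPlot _ d n (fun z => plotTangent p hp (y z) (v z))

/-- The diffeology of the internal tangent bundle: the smallest one for which `TX → X` is a vector
pseudo-bundle and all maps `Tp` are smooth. -/
instance tangentBundleDiffeology : DiffeologicalSpace (IntTangentBundle X) :=
  sInf {d | IsTangentDiffeology d}

/-- The smallest such diffeology exists. -/
lemma isTangentDiffeology_tangentBundle :
    IsTangentDiffeology (tangentBundleDiffeology (X := X)) where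
  proj n a ha := by
    let d₀ : DiffeologicalSpace (IntTangentBundle X) :=
      inducedDiffeology (fun b : IntTangentBundle X => b.base)
    have h₀ : IsTangentDiffeology d₀ :=
      { proj := fun n a ha => ha
        add := fun n x a b ha _ => ha
        smul := fun n r x a _ ha => ha
        zero := fun n x hx => hx
        plotTangent := fun m p hp n y v hy _ => isPlot_reparam hp hy.contDiff }
    exact DiffeologicalSpace.isPlot_sInf_iff.1 ha d₀ h₀
  add n x a b ha hb := DiffeologicalSpace.isPlot_sInf_iff.2 fun d hd =>
    hd.add n x a b (DiffeologicalSpace.isPlot_sInf_iff.1 ha d hd)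
      (DiffeologicalSpace.isPlot_sInf_iff.1 hb d hd)
  smul n r x a hr ha := DiffeologicalSpace.isPlot_sInf_iff.2 fun d hd =>
    hd.smul n r x a hr (DiffeologicalSpace.isPlot_sInf_iff.1 ha d hd)
  zero n x hx := DiffeologicalSpace.isPlot_sInf_iff.2 fun d hd => hd.zero n x hx
  plotTangent m p hp n y v hy hv := DiffeologicalSpace.isPlot_sInf_iff.2 fun d hd =>
    hd.plotTangent m p hp n y v hy hv

/-- `T_x X` carries the subset diffeology as a fibre of `TX`. -/
instance tangentSpaceDiffeology (x : X) : DiffeologicalSpace (IntTangentSpace x) :=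
  inducedDiffeology (IntTangentBundle.mk x)

/-- The velocity `dc/dt` at `t` of a smooth curve `c : ℝ → X`. -/
def velocity (c : SmoothMap ℝ X) (t : ℝ) : IntTangentBundle X :=
  plotTangent (fun z : Euc 1 => c (z 0))
    (IsPlot.dSmooth_comp (p := fun z : Euc 1 => z 0)
      (ContDiff.isPlot (contDiff_piLp_apply (p := 2))) c.smooth)
    (EuclideanSpace.single 0 t) (EuclideanSpace.single 0 1)

/-- `a` is the velocity at `t` of a curve `c` whose domain `D` is a neighbourhood of `t`. Velocities
only depend on germs, so they are computed from any smooth curve `ℝ → X` that agrees with `c`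
near `t`. -/
def HasVelocityAt {D : Set ℝ} (c : D → X) (t : ℝ) (a : IntTangentBundle X) : Prop :=
  ∃ q : SmoothMap ℝ X, (∀ᶠ s in 𝓝 t, ∃ h : s ∈ D, q s = c ⟨s, h⟩) ∧ velocity q t = a

end Tangent

/-! ### Regular diffeological Lie groups -/

section Groups

/-- Diffeological groups. -/
class IsDiffeologicalGroup (G : Type u) [Group G] [DiffeologicalSpace G] : Prop where
  smooth_mul : DSmooth (fun a : G × G => a.1 * a.2)
  smooth_inv : DSmooth (fun g : G => g⁻¹)

/-- Smooth actions of a diffeological group. -/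
class IsSmoothAction (G : Type u) (E : Type v) [Group G] [DiffeologicalSpace G]
    [DiffeologicalSpace E] [MulAction G E] : Prop where
  smooth_smul : DSmooth (fun a : G × E => a.1 • a.2)

/-- Maps of class `C^k` from `ℝⁿ` to a topological vector space: the iterated directional
derivatives up to order `k` exist and are continuous. -/
def IsCkInto {W : Type u} [AddCommGroup W] [Module ℝ W] [TopologicalSpace W] {n : ℕ} :
    ℕ → (Euc n → W) → Prop
  | 0, f => Continuous f
  | k + 1, f => Continuous f ∧ ∀ v : Euc n, ∃ f' : Euc n → W,
      (∀ z, Tendsto (fun t : ℝ => t⁻¹ • (f (z + t • v) - f z)) (𝓝[≠] 0) (𝓝 (f' z))) ∧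
      IsCkInto k f'

/-- Smooth maps from `ℝⁿ` to a topological vector space. -/
def IsSmoothInto {W : Type u} [AddCommGroup W] [Module ℝ W] [TopologicalSpace W] {n : ℕ}
    (f : Euc n → W) : Prop := ∀ k : ℕ, IsCkInto k f

variable (G : Type u) [Group G] [DiffeologicalSpace G]

/-- Diffeological Lie groups. -/
structure IsDiffeologicalLieGroup [IsDiffeologicalGroup G] : Prop where
  /-- The smooth linear functionals separate the points of `T_e G`. -/
  separating : ∀ ξ : IntTangentSpace (1 : G), ξ ≠ 0 →
    ∃ l : IntTangentSpace (1 : G) →ₗ[ℝ] ℝ, DSmooth l ∧ l ξ ≠ 0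
  /-- The plots of `T_e G` smoothly factor through a (smooth) map `φ : V → T_e G`, where `V` is an
  open subset of a complete Hausdorff locally convex topological vector space `W`. -/
  factor : ∃ (W : Type u) (_ : AddCommGroup W) (_ : Module ℝ W) (_ : UniformSpace W)
    (_ : IsUniformAddGroup W) (_ : ContinuousSMul ℝ W) (_ : LocallyConvexSpace ℝ W)
    (_ : CompleteSpace W) (_ : T2Space W) (V : Set W) (φ : V → IntTangentSpace (1 : G)),
    IsOpen V ∧
    (∀ (n : ℕ) (f : Euc n → W) (hf : ∀ z, f z ∈ V), IsSmoothInto f →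
      IsPlot (fun z => φ ⟨f z, hf z⟩)) ∧
    (∀ (n : ℕ) (p : Euc n → IntTangentSpace (1 : G)), IsPlot p →
      ∃ (f : Euc n → W) (hf : ∀ z, f z ∈ V), IsSmoothInto f ∧ ∀ z, p z = φ ⟨f z, hf z⟩)

variable {G}

/-- Right multiplication `R_h`. -/
def rightMul [IsDiffeologicalGroup G] (h : G) : SmoothMap G G where
  toFun g := g * h
  smooth := (IsDiffeologicalGroup.smooth_mul (G := G)).comp
    (dSmooth_prodMk dSmooth_id' dSmooth_const)

/-- `g : [0,1] → G` solves `g(0) = e`, `(R_{g(t)⁻¹})_* (dg/dt) = ξ(t)`. The interval `[0,1]` has the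
subset diffeology, for which velocities exist at the interior points. -/
structure IsEvolution [IsDiffeologicalGroup G]
    (ξ : SmoothMap (Icc (0 : ℝ) 1) (IntTangentSpace (1 : G)))
    (g : SmoothMap (Icc (0 : ℝ) 1) G) : Prop where
  init : g ⟨0, by simp⟩ = 1
  eqn : ∀ (t : ℝ) (ht : t ∈ Ioo (0 : ℝ) 1), ∃ a : IntTangentBundle G,
    HasVelocityAt g.toFun t a ∧
    tangentMap (rightMul (g ⟨t, Ioo_subset_Icc_self ht⟩)⁻¹) a
      = ⟨1, ξ ⟨t, Ioo_subset_Icc_self ht⟩⟩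

variable (G)

/-- Regularity: the equation has a unique solution for every smooth `ξ : [0,1] → T_e G`, and the
solution map `exp : C^∞([0,1], T_e G) → C^∞([0,1], G)` is smooth. -/
def IsRegularGroup [IsDiffeologicalGroup G] : Prop :=
  ∃ exp : SmoothMap (Icc (0 : ℝ) 1) (IntTangentSpace (1 : G)) → SmoothMap (Icc (0 : ℝ) 1) G,
    DSmooth exp ∧ ∀ ξ, IsEvolution ξ (exp ξ) ∧ ∀ g, IsEvolution ξ g → g = exp ξ

end Groups

/-! ### Principal bundles -/

section Bundles

variable {X : Type u} {Y : Type w} {E : Type v}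
variable [DiffeologicalSpace X] [DiffeologicalSpace Y] [DiffeologicalSpace E]

/-- The total space `f^*E` of a pullback. -/
abbrev Pullback (f : Y → X) (π : E → X) : Type (max v w) := {a : Y × E // f a.1 = π a.2}

/-- The restriction of `π` to a subset `U` is trivial with fibre `F`. -/
def IsTrivialOver (π : E → X) (U : Set X) (F : Type w) [DiffeologicalSpace F] : Prop :=
  ∃ φ : Diffeo (Pullback (Subtype.val : U → X) π) (U × F), ∀ a, (φ.toFun a).1 = a.1.1

/-- Principal `G`-bundles: `π` is a smooth surjection which, pulled back by any plot, is locally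
equivariantly trivial. (This includes local triviality, with fibre `G`, of the pullbacks. The
equivariance of `ψ` and the `G`-invariance of `π` are contained in the formula for `ψ`.) -/
structure IsPrincipalBundle (G : Type w) [Group G] [DiffeologicalSpace G] [MulAction G E]
    [IsSmoothAction G E] (π : SmoothMap E X) : Prop where
  surjective : Function.Surjective π
  locallyTrivial : ∀ (n : ℕ) (p : Euc n → X), IsPlot p → ∀ z : Euc n,
    ∃ V : Set (Euc n), IsOpen V ∧ z ∈ V ∧ ∃ q : V → E, DSmooth q ∧ (∀ y : V, π (q y) = p y) ∧
      ∃ ψ : Diffeo (V × G) (Pullback (fun y : V => p y) π),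
        ∀ (y : V) (g : G), (ψ.toFun (y, g)).1 = (y, g • q y)

/-- Weak D-numerability: there are a countable local trivialisation `(U_i)` and a pointwise-finite
smooth partition of unity `(ζ_i)` such that `ζ_i⁻¹((0,1]) ⊆ U_i`. -/
def IsWeaklyDNumerable (π : SmoothMap E X) : Prop :=
  ∃ (F : Type v) (_ : DiffeologicalSpace F) (U : ℕ → Set X) (ζ : ℕ → X → ℝ),
    (∀ i, IsOpen[dTopology] (U i)) ∧ (⋃ i, U i) = univ ∧
    (∀ i, IsTrivialOver π (U i) F) ∧
    (∀ i, DSmooth (ζ i)) ∧ (∀ i x, 0 ≤ ζ i x) ∧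
    (∀ x, {i | ζ i x ≠ 0}.Finite) ∧ (∀ x, ∑ᶠ i, ζ i x = 1) ∧
    ∀ i x, 0 < ζ i x → x ∈ U i

/-- The D-topology is Hausdorff. -/
def IsDHausdorff (X : Type u) [DiffeologicalSpace X] : Prop := @T2Space X dTopology

/-- Smooth paracompactness: the D-topology is paracompact, and every open cover has a subordinate
smooth partition of unity. -/
structure IsSmoothlyParacompact (X : Type u) [DiffeologicalSpace X] : Prop where
  paracompact : @ParacompactSpace X dTopology
  partition : ∀ (ι : Type u) (U : ι → Set X), (∀ i, IsOpen[dTopology] (U i)) →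
    (⋃ i, U i) = univ → ∃ ζ : ι → X → ℝ,
      (∀ i, DSmooth (ζ i)) ∧ (∀ i x, 0 ≤ ζ i x) ∧
      @LocallyFinite ι X dTopology (fun i => Function.support (ζ i)) ∧
      (∀ x, ∑ᶠ i, ζ i x = 1) ∧
      ∀ i, @closure X dTopology (Function.support (ζ i)) ⊆ U i

end Bundles

/-! ### Diffeological connections -/

section Connections

/-- Local paths: smooth curves defined on (nonempty, possibly unbounded) open intervals. -/
@[ext]
structure LocalPath (X : Type u) [DiffeologicalSpace X] where
  /-- The domain. -/
  dom : Set ℝ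
  isOpen_dom : IsOpen dom
  ordConnected_dom : dom.OrdConnected
  nonempty_dom : dom.Nonempty
  /-- The path. -/
  toFun : dom → X
  smooth : DSmooth toFun

variable {X : Type u} {E : Type v} [DiffeologicalSpace X] [DiffeologicalSpace E]

/-- The condition for a parametrisation of local paths to be a plot of the standard functional
diffeology. -/
def IsLocalPathPlot {n : ℕ} (p : Euc n → LocalPath X) : Prop :=
  ∀ (z : Euc n) (t : ℝ), t ∈ (p z).dom →
    ∃ (U : Set (Euc n)) (V : Set ℝ), IsOpen U ∧ z ∈ U ∧ IsOpen V ∧ t ∈ V ∧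
      ∃ h : ∀ y ∈ U, V ⊆ (p y).dom,
        DSmooth (fun a : U × V => (p a.1).toFun ⟨a.2, h a.1 a.1.2 a.2.2⟩)

/-- The standard functional diffeology on the set of local paths. -/
instance localPathDiffeology : DiffeologicalSpace (LocalPath X) where
  plots _ := {p | IsLocalPathPlot p}
  constant_plots γ := fun z t ht => ⟨univ, γ.dom, isOpen_univ, trivial, γ.isOpen_dom, ht,
    fun _ _ => Subset.rfl, γ.smooth.comp dSmooth_snd⟩
  plot_reparam := by
    intro n m p f hp hf z t ht
    obtain ⟨U, V, hU, hz, hV, htV, h, hs⟩ := hp (f z) t ht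
    refine ⟨f ⁻¹' U, V, hU.preimage hf.continuous, hz, hV, htV, fun y hy => h _ hy, ?_⟩
    intro k a ha
    exact hs k (fun y => (⟨f (a y).1, (a y).1.2⟩, (a y).2)) ⟨isPlot_reparam
      (IsPlot.dSmooth (show IsPlot f from hf.isPlot) k _ ha.1) contDiff_id, ha.2⟩
  locality := by
    intro n p H z t ht
    obtain ⟨s, hs, hzs, hp⟩ := H z
    obtain ⟨ε, hε, hεs⟩ := Metric.isOpen_iff.1 hs z hzs
    let e := OpenPartialHomeomorph.univBall z ε
    have he_src : e.source = univ := OpenPartialHomeomorph.univBall_source z ε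
    have he_tgt : e.target = Metric.ball z ε := OpenPartialHomeomorph.univBall_target z hε
    have he0 : e 0 = z := OpenPartialHomeomorph.univBall_apply_zero z ε
    have hplot : IsLocalPathPlot (p ∘ e) := hp (f := e)
      (fun x => hεs (he_tgt ▸ e.map_source (he_src ▸ mem_univ x)))
      OpenPartialHomeomorph.contDiff_univBall
    obtain ⟨U, V, hU, h0, hV, htV, h, hsm⟩ := hplot 0 t (by simpa [he0] using ht)
    have hsymm : ∀ y ∈ e.target, e (e.symm y) = y := fun y hy => e.right_inv hy
    refine ⟨e.target ∩ e.symm ⁻¹' U, V, e.symm.isOpen_inter_preimage hU,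
      ⟨?_, ?_⟩, hV, htV, ?_, ?_⟩
    · rw [he_tgt]; exact Metric.mem_ball_self hε
    · have : e.symm z = 0 := by rw [← he0]; exact e.left_inv (he_src ▸ mem_univ _)
      simpa [this] using h0
    · intro y hy
      have := h (e.symm y) hy.2
      simpa [hsymm y hy.1] using this
    · intro k a ha
      have h1 : IsPlot (fun y => e.symm ((a y).1 : Euc n)) := by
        refine ContDiff.isPlot (contDiffOn_univ.1 ?_)
        refine (OpenPartialHomeomorph.contDiffOn_univBall_symm (c := z) (r := ε)).comp
          (contDiffOn_univ.2 (IsPlot.contDiff ha.1)) ?_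
        intro y _
        exact he_tgt ▸ (a y).1.2.1
      have h2 := hsm k (fun y => (⟨e.symm ((a y).1 : Euc n), (a y).1.2.2⟩, (a y).2)) ⟨h1, ha.2⟩
      have key : ∀ (y₁ y₂ : Euc n) (r : ℝ) (h₁ : r ∈ (p y₁).dom) (h₂ : r ∈ (p y₂).dom), y₁ = y₂ →
          (p y₁).toFun ⟨r, h₁⟩ = (p y₂).toFun ⟨r, h₂⟩ := by
        rintro y₁ _ r h₁ h₂ rfl; rfl
      refine Eq.mpr (congrArg IsPlot (funext fun y => ?_)) h2
      exact key _ _ _ _ _ (hsymm _ (a y).1.2.1).symm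

namespace LocalPath

/-- The path `π ∘ γ`. -/
def map (π : SmoothMap E X) (γ : LocalPath E) : LocalPath X where
  dom := γ.dom
  isOpen_dom := γ.isOpen_dom
  ordConnected_dom := γ.ordConnected_dom
  nonempty_dom := γ.nonempty_dom
  toFun := fun t => π (γ.toFun t)
  smooth := π.smooth.comp γ.smooth

/-- The path `γ ∘ f`, for a smooth map `f` from an open interval to the domain of `γ`. -/
def comp (γ : LocalPath E) (f : LocalPath ℝ) (hf : ∀ s, f.toFun s ∈ γ.dom) : LocalPath E where
  dom := f.dom
  isOpen_dom := f.isOpen_dom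
  ordConnected_dom := f.ordConnected_dom
  nonempty_dom := f.nonempty_dom
  toFun := fun s => γ.toFun ⟨f.toFun s, hf s⟩
  smooth := DSmooth.comp (g := γ.toFun) γ.smooth
    (f := fun s => (⟨f.toFun s, hf s⟩ : γ.dom)) (fun n p hp => f.smooth n p hp)

/-- The path `t ↦ k(t) · γ(t)`, for a smooth map `k` from the domain of `γ` to `G`. -/
def smul {G : Type w} [Group G] [DiffeologicalSpace G] [MulAction G E] [IsSmoothAction G E]
    (γ : LocalPath E) (k : SmoothMap γ.dom G) : LocalPath E where
  dom := γ.dom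
  isOpen_dom := γ.isOpen_dom
  ordConnected_dom := γ.ordConnected_dom
  nonempty_dom := γ.nonempty_dom
  toFun := fun t => k t • γ.toFun t
  smooth := (IsSmoothAction.smooth_smul (G := G) (E := E)).comp
    (dSmooth_prodMk k.smooth γ.smooth)

/-- The path `t ↦ g · γ(t)`, for `g ∈ G`. -/
def constSMul {G : Type w} [Group G] [DiffeologicalSpace G] [MulAction G E] [IsSmoothAction G E]
    (g : G) (γ : LocalPath E) : LocalPath E := γ.smul ⟨fun _ => g, dSmooth_const⟩

/-- `γ` passes through `y` at time `t`. -/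
def PassesThrough (γ : LocalPath E) (t : ℝ) (y : E) : Prop :=
  ∃ h : t ∈ γ.dom, γ.toFun ⟨t, h⟩ = y

end LocalPath

/-- The tautological bundle of local paths, with the subset diffeology of `Paths_loc(E) × ℝ`. -/
abbrev TbPaths (E : Type v) [DiffeologicalSpace E] : Type v :=
  {a : LocalPath E × ℝ // a.2 ∈ a.1.dom}

/-- The point `(γ, t)` of the tautological bundle. -/
abbrev TbPaths.mk (γ : LocalPath E) (t : γ.dom) : TbPaths E := ⟨(γ, t), t.2⟩

/-- Diffeological connections on a principal `G`-bundle, in the sense of Iglesias-Zemmour. -/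
structure IsDiffeologicalConnection (G : Type w) [Group G] [DiffeologicalSpace G] [MulAction G E]
    [IsSmoothAction G E] (π : SmoothMap E X) (θ : TbPaths E → LocalPath E) : Prop where
  smooth : DSmooth θ
  dom_eq : ∀ (γ : LocalPath E) (t₀ : γ.dom), (θ (.mk γ t₀)).dom = γ.dom
  map_eq : ∀ (γ : LocalPath E) (t₀ : γ.dom), (θ (.mk γ t₀)).map π = γ.map π
  base : ∀ (γ : LocalPath E) (t₀ : γ.dom), (θ (.mk γ t₀)).PassesThrough t₀ (γ.toFun t₀)
  /-- For constant `k` this is `θ(g · γ, t₀) = g · θ(γ, t₀)`. -/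
  smul : ∀ (γ : LocalPath E) (t₀ : γ.dom) (k : SmoothMap γ.dom G),
    θ (.mk (γ.smul k) t₀) = (θ (.mk γ t₀)).constSMul (k t₀)
  comp : ∀ (γ : LocalPath E) (f : LocalPath ℝ) (hf : ∀ s, f.toFun s ∈ γ.dom) (s : f.dom),
    θ (.mk (γ.comp f hf) s) = (θ (.mk γ ⟨f.toFun s, hf s⟩)).comp f
      (fun r => (dom_eq γ ⟨f.toFun s, hf s⟩).symm ▸ hf r)
  proj : ∀ (γ : LocalPath E) (t₀ : γ.dom),
    θ (.mk (θ (.mk γ t₀)) ⟨t₀, (dom_eq γ t₀).symm ▸ t₀.2⟩) = θ (.mk γ t₀)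

/-- `γ` is horizontal with respect to the base time `t`. -/
def IsHorizontalAt (θ : TbPaths E → LocalPath E) (γ : LocalPath E) (t : ℝ) : Prop :=
  ∃ h : t ∈ γ.dom, θ (.mk γ ⟨t, h⟩) = γ

/-- `γ` is horizontal (with respect to every base time in its domain). -/
def IsHorizontal (θ : TbPaths E → LocalPath E) (γ : LocalPath E) : Prop :=
  ∀ t ∈ γ.dom, IsHorizontalAt θ γ t

end Connections

end DiffBundle

end

open DiffBundle

noncomputable section

namespace DiffBundle

/-! ### Germs of smooth maps -/

section Germs

variable {V : Type*} [TopologicalSpace V] [DiffeologicalSpace V]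
variable {X : Type*} {Y : Type*} {Z : Type*}
variable [DiffeologicalSpace X] [DiffeologicalSpace Y] [DiffeologicalSpace Z]

/-! The connection is parallel transport for a connection form that is evaluated directly on curves.
Relative to a local section `s_i`, a curve `γ` in `E` has a coordinate `g_i` with `γ = g_i • s_i(π
γ)`, and `connForm`, written `ω` here, averages the right logarithmic derivatives `δ g_i` in `T_e G`
with the weights of a partition of unity. The weights must be locally finite and vanish near the
points where the coordinate may fail to be smooth; `exists_locallyFinite_partition` extracts such
weights from pointwise-finite ones. Because they sum to 1, averaging preserves the gauge law `ω(kγ)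
= δk + Ad_k ω(γ)` (`connForm_smul`), and the chain rule gives `ω(γ ∘ f) = f' · ω(γ) ∘ f`
(`connForm_comp`).

Regularity of `G`, rescaled from `[0,1]` to arbitrary segments, solves `δu = ω(γ)`, `u(t₀) = 1` on
open intervals, uniquely (`eq_solve`) and smoothly in all data (`dSmoothAt_solve`). Regularity
speaks only of interior times, so the equation at the initial time is recovered by continuity,
tested against the smooth functionals that separate `T_e G` (`logDeriv_solve`). Put `θ(γ, t₀) = u⁻¹
γ`. By uniqueness, the solution for `kγ` is `k u k(t₀)⁻¹`, and the solution for `γ ∘ f` is `u ∘ f`.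
These rules give axioms 3 and 4, and the first one with `k = u⁻¹` gives axiom 5.

A curve whose form vanishes is horizontal. Such lifts exist locally, since any local lift can be
corrected by `u⁻¹`; two of them differ by a constant group element on a common interval, so they
extend over the whole interval. Uniqueness is again axiom 3: another lift through the same point is
`kγ` with `k(t₀) = 1`, hence `θ(kγ, t₀) = θ(γ, t₀) = γ`. -/

/-- The germ of `f` at `x` is the germ of a smooth map. -/
def DSmoothAt (f : V → X) (x : V) : Prop := ∃ q : V → X, DSmooth q ∧ f =ᶠ[𝓝 x] q

/-- `f` is smooth on a subset. -/
def DSmoothOn (f : X → Y) (s : Set X) : Prop :=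
  ∀ (n : ℕ) (p : Euc n → X), IsPlot p → (∀ z, p z ∈ s) → IsPlot (fun z => f (p z))

lemma _root_.Diffeology.DSmooth.dSmoothAt {f : V → X} (hf : DSmooth f) (x : V) : DSmoothAt f x :=
  ⟨f, hf, EventuallyEq.rfl⟩

lemma DSmoothAt.congr {f g : V → X} {x : V} (hf : DSmoothAt f x) (h : g =ᶠ[𝓝 x] f) :
    DSmoothAt g x := by
  obtain ⟨q, hq, hfq⟩ := hf
  exact ⟨q, hq, h.trans hfq⟩

lemma DSmoothAt.eventually {f : V → X} {x : V} (hf : DSmoothAt f x) :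
    ∀ᶠ y in 𝓝 x, DSmoothAt f y := by
  obtain ⟨q, hq, hfq⟩ := hf
  filter_upwards [hfq.eventuallyEq_nhds] with y hy using ⟨q, hq, hy⟩

lemma dSmoothAt_const (c : X) (x : V) : DSmoothAt (fun _ : V => c) x :=
  dSmooth_const.dSmoothAt x

lemma DSmoothAt.dSmooth_comp {g : X → Y} (hg : DSmooth g) {f : V → X} {x : V}
    (hf : DSmoothAt f x) : DSmoothAt (fun y => g (f y)) x := by
  obtain ⟨q, hq, hfq⟩ := hf
  exact ⟨fun y => g (q y), hg.comp hq, hfq.fun_comp g⟩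

lemma DSmoothAt.prodMk {f : V → X} {g : V → Y} {x : V} (hf : DSmoothAt f x)
    (hg : DSmoothAt g x) : DSmoothAt (fun y => (f y, g y)) x := by
  obtain ⟨q, hq, hfq⟩ := hf
  obtain ⟨r, hr, hgr⟩ := hg
  refine ⟨fun y => (q y, r y), dSmooth_prodMk hq hr, ?_⟩
  filter_upwards [hfq, hgr] with y h1 h2
  simp only [h1, h2]

end Germs

/-! ### Smooth germs on normed spaces: cutoffs, composition, locality -/

section LocalSmoothness

variable {V : Type*} [NormedAddCommGroup V] [NormedSpace ℝ V]
variable {W : Type*} [NormedAddCommGroup W] [NormedSpace ℝ W]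
variable {X : Type*} {Y : Type*} {Z : Type*}
variable [DiffeologicalSpace X] [DiffeologicalSpace Y] [DiffeologicalSpace Z]

/-- Maps into an open set that are the identity near a given point. -/
lemma exists_smooth_into [FiniteDimensional ℝ V] {U : Set V} {x : V} (hU : U ∈ 𝓝 x) :
    ∃ β : V → V, ContDiff ℝ ∞ β ∧ (∀ y, β y ∈ U) ∧ ∀ᶠ y in 𝓝 x, β y = y := by
  obtain ⟨ε, hε, hεU⟩ := Metric.mem_nhds_iff.1 hU
  let f : ContDiffBump x := ⟨ε / 2, ε, by positivity, by linarith⟩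
  -- Contract radially towards `x` by a bump function: the factor is 1 near `x` and 0 outside the
  -- `ε`-ball.
  refine ⟨fun y => x + f y • (y - x), ?_, fun y => hεU ?_, ?_⟩
  · exact contDiff_const.add (f.contDiff.smul (contDiff_id.sub contDiff_const))
  · rw [Metric.mem_ball, dist_eq_norm, add_sub_cancel_left, norm_smul, Real.norm_eq_abs,
      abs_of_nonneg f.nonneg]
    by_cases h : dist y x < ε
    · rw [dist_eq_norm] at h
      calc f y * ‖y - x‖ ≤ 1 * ‖y - x‖ := by gcongr; exact f.le_one
        _ < ε := by rwa [one_mul]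
    · rw [f.zero_of_le_dist (not_lt.1 h), zero_mul]; exact hε
  · filter_upwards [f.eventuallyEq_one] with y hy
    rw [hy]; simp

variable [DiffeologicalSpace V] [DiffeologicalSpace W]
variable [IsContDiffCompatible V] [IsContDiffCompatible W]

/-- Lets germs on `V × ℝ` (parameters and time) be handled by ordinary calculus. -/
instance prodIsContDiffCompatible :
    IsContDiffCompatible (V × W) where
  isPlot_iff {n p} := by
    refine ⟨fun h => ?_, fun h => ⟨h.fst.isPlot, h.snd.isPlot⟩⟩
    exact (IsPlot.contDiff h.1).prodMk (IsPlot.contDiff h.2)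

lemma DSmoothAt.continuousAt [FiniteDimensional ℝ V] {f : V → W} {x : V} (hf : DSmoothAt f x) :
    ContinuousAt f x := by
  obtain ⟨q, hq, hfq⟩ := hf
  exact hq.contDiff.continuous.continuousAt.congr hfq.symm

lemma DSmoothAt.comp [FiniteDimensional ℝ V] {f : W → X} {g : V → W} {x : V}
    (hf : DSmoothAt f (g x)) (hg : DSmoothAt g x) : DSmoothAt (fun y => f (g y)) x := by
  have hc := hg.continuousAt
  obtain ⟨q, hq, hfq⟩ := hf
  obtain ⟨r, hr, hgr⟩ := hg
  refine ⟨fun y => q (r y), hq.comp hr, ?_⟩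
  filter_upwards [hc.eventually hfq, hgr] with y h1 h2
  rw [h1, h2]

lemma DSmoothAt.comp_of_eq [FiniteDimensional ℝ V] {f : W → X} {g : V → W} {x : V} {y : W}
    (hf : DSmoothAt f y) (hg : DSmoothAt g x) (h : g x = y) : DSmoothAt (fun y => f (g y)) x :=
  DSmoothAt.comp (h ▸ hf) hg

/-- The locality axiom in terms of germs; every local smoothness argument is turned back into a plot
here. -/
lemma isPlot_of_dSmoothAt {n : ℕ} {p : Euc n → X} (h : ∀ z, DSmoothAt p z) : IsPlot p := by
  refine DiffeologicalSpace.locality fun z => ?_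
  obtain ⟨q, hq, hpq⟩ := h z
  obtain ⟨U, hU, hUo, hz⟩ := eventually_nhds_iff.1 hpq
  refine ⟨U, hUo, hz, fun {m f} hf hc => ?_⟩
  have : p ∘ f = q ∘ f := funext fun y => hU _ (hf y)
  exact this ▸ hq m f hc.isPlot

/-- Plots live on `Euc n` only, so `V` is identified with a Euclidean space. -/
lemma dSmooth_iff_isPlot_comp [FiniteDimensional ℝ V] {f : V → X} :
    DSmooth f ↔ IsPlot (f ∘ (toEuclidean (E := V)).symm) := by
  refine ⟨fun h => h _ _ (ContDiff.isPlot (toEuclidean (E := V)).symm.contDiff), fun h => ?_⟩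
  have : f = (f ∘ (toEuclidean (E := V)).symm) ∘ toEuclidean (E := V) := by
    ext x; simp
  rw [this]
  exact h.dSmooth.comp (ContDiff.dSmooth (toEuclidean (E := V)).contDiff)

/-- D-open sets have open preimages. -/
lemma _root_.Diffeology.DSmooth.isOpen_preimage [FiniteDimensional ℝ V] {q : V → X}
    (hq : DSmooth q) {U : Set X} (hU : IsOpen[dTopology] U) : IsOpen (q ⁻¹' U) := by
  have h := isOpen_iff_preimages_plots.1 hU _ _ (dSmooth_iff_isPlot_comp.1 hq)
  have := h.preimage (toEuclidean (E := V)).continuous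
  simpa [← preimage_comp, Function.comp_assoc] using this

lemma DSmoothAt.eventually_mem [FiniteDimensional ℝ V] {f : V → X} {x : V}
    (hf : DSmoothAt f x) {U : Set X} (hU : IsOpen[dTopology] U) (hx : f x ∈ U) :
    ∀ᶠ y in 𝓝 x, f y ∈ U := by
  obtain ⟨q, hq, hfq⟩ := hf
  have h := (hq.isOpen_preimage hU).mem_nhds (show q x ∈ U from hfq.eq_of_nhds ▸ hx)
  filter_upwards [hfq, h] with y h1 h2
  rw [h1]; exact h2

lemma DSmoothOn.comp_dSmooth {f : Y → Z} {s : Set Y} (hf : DSmoothOn f s) {g : X → Y}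
    (hg : DSmooth g) (h : ∀ x, g x ∈ s) : DSmooth (fun x => f (g x)) :=
  fun n p hp => hf n (fun z => g (p z)) (hg n p hp) fun _ => h _

/-- Germs of compositions with maps that are smooth on a subset. -/
lemma DSmoothOn.comp_dSmoothAt [FiniteDimensional ℝ V] {g : X → Y} {s : Set X}
    (hg : DSmoothOn g s) {f : V → X} {x : V} (hf : DSmoothAt f x) (hs : ∀ᶠ y in 𝓝 x, f y ∈ s) :
    DSmoothAt (fun y => g (f y)) x := by
  obtain ⟨q, hq, hfq⟩ := hf
  -- Precomposing with `β` keeps the representative `q` inside `s` everywhere, without changing its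
  -- germ at `x`.
  obtain ⟨β, hβ, hβU, hβx⟩ := exists_smooth_into (hfq.and hs)
  refine ⟨fun y => g (q (β y)), hg.comp_dSmooth (hq.comp hβ.dSmooth) fun y => ?_, ?_⟩
  · obtain ⟨h1, h2⟩ := hβU y
    rwa [h1] at h2
  · filter_upwards [hβx, hfq] with y h1 h2
    rw [h1, h2]

/-- A map that is smooth near a point has a smooth germ. -/
lemma DSmoothOn.dSmoothAt [FiniteDimensional ℝ V] {g : V → X} {s : Set V} (hg : DSmoothOn g s)
    {x : V} (hs : s ∈ 𝓝 x) : DSmoothAt g x :=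
  hg.comp_dSmoothAt (dSmooth_id'.dSmoothAt x) hs

lemma dSmoothOn_of_restrict {g : X → Y} {s : Set X} (h : DSmooth (fun x : s => g x)) :
    DSmoothOn g s := fun n p hp hs => h n (fun z => ⟨p z, hs z⟩) hp

lemma _root_.ContDiff.dSmoothAt {f : V → W} (hf : ContDiff ℝ ∞ f) (x : V) : DSmoothAt f x :=
  hf.dSmooth.dSmoothAt x

end LocalSmoothness

/-! ### Velocities of curves in a fixed internal tangent space -/

section Velocities

variable {X : Type*} {Y : Type*} [DiffeologicalSpace X] [DiffeologicalSpace Y]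
variable {V : Type*} [NormedAddCommGroup V] [NormedSpace ℝ V] [FiniteDimensional ℝ V]
variable [DiffeologicalSpace V] [IsContDiffCompatible V]

lemma dSmooth_tangentSpace_add (x : X) :
    DSmooth (fun a : IntTangentSpace x × IntTangentSpace x => a.1 + a.2) := fun n p hp =>
  isTangentDiffeology_tangentBundle.add n (fun _ => x) (fun z => (p z).1) (fun z => (p z).2)
    hp.1 hp.2

lemma dSmooth_tangentSpace_smul (x : X) :
    DSmooth (fun a : ℝ × IntTangentSpace x => a.1 • a.2) := fun n p hp =>
  isTangentDiffeology_tangentBundle.smul n (fun z => (p z).1) (fun _ => x) (fun z => (p z).2)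
    hp.1 hp.2

lemma dSmoothAt_tangentSpace_sum {W : Type*} [TopologicalSpace W] [DiffeologicalSpace W] {x : X}
    {ι : Type*} {f : ι → W → IntTangentSpace x} {z : W} (s : Finset ι)
    (hf : ∀ i ∈ s, DSmoothAt (f i) z) : DSmoothAt (fun w => ∑ i ∈ s, f i w) z := by
  classical
  induction s using Finset.induction_on with
  | empty => simpa using dSmoothAt_const _ z
  | insert i s his ih =>
    simp only [Finset.sum_insert his]
    exact ((hf i (Finset.mem_insert_self i s)).prodMk
      (ih fun j hj => hf j (Finset.mem_insert_of_mem hj))).dSmooth_comp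
      (dSmooth_tangentSpace_add x)

/-- Tangent vectors only depend on germs of plots. -/
lemma PointedPlot.push_eq_of_eventuallyEq {x : X} (p q : PointedPlot x)
    (f : Euc p.dim → Euc q.dim) (hf : ContDiff ℝ ∞ f) (hf0 : f 0 = 0)
    (h : ∀ᶠ z in 𝓝 0, p.toFun z = q.toFun (f z)) (v : Euc p.dim) :
    p.push v = q.push (fderiv ℝ f 0 v) := by
  -- The defining relations need a global factorisation. The plot `p ∘ β` has arrows `β` to `p` and
  -- `f ∘ β` to `q`, and `β` has derivative the identity at 0.
  obtain ⟨β, hβ, hβU, hβ0⟩ := exists_smooth_into h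
  have hβ00 : β 0 = 0 := hβ0.self_of_nhds
  let r : PointedPlot x := ⟨p.dim, fun z => p.toFun (β z), isPlot_reparam p.isPlot hβ, by
    rw [hβ00, p.map_zero]⟩
  have h1 : r.push v = p.push (fderiv ℝ β 0 v) :=
    PointedPlot.push_eq r p β hβ hβ00 (fun z => rfl) v
  have h2 : r.push v = q.push (fderiv ℝ (fun z => f (β z)) 0 v) :=
    PointedPlot.push_eq r q (fun z => f (β z)) (hf.comp hβ) (by rw [hβ00, hf0]) hβU v
  have e1 : fderiv ℝ β 0 = ContinuousLinearMap.id ℝ _ := by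
    rw [Filter.EventuallyEq.fderiv_eq (show β =ᶠ[𝓝 0] id from hβ0), fderiv_id]
  have e2 : fderiv ℝ (fun z => f (β z)) 0 = fderiv ℝ f 0 := by
    refine Filter.EventuallyEq.fderiv_eq ?_
    filter_upwards [hβ0] with z hz
    rw [hz]
  rw [e1] at h1
  rw [e2] at h2
  exact h1.symm.trans h2

/-- A smooth map `q : V → X` on a finite-dimensional vector space as a pointed plot. -/
def PointedPlot.ofSmooth {x : X} (q : V → X) (hq : DSmooth q) (h : q 0 = x) : PointedPlot x where
  dim := Module.finrank ℝ V
  toFun := q ∘ (toEuclidean (E := V)).symm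
  isPlot := dSmooth_iff_isPlot_comp.1 hq
  map_zero := by simp [h]

/-- The derivative at `0` of a smooth map `q : V → X` with `q 0 = x`. -/
def pushSmooth {x : X} (q : V → X) (hq : DSmooth q) (h : q 0 = x) : V →ₗ[ℝ] IntTangentSpace x :=
  (PointedPlot.ofSmooth q hq h).push ∘ₗ (toEuclidean (E := V)).toLinearEquiv.toLinearMap

open Classical in
/-- The velocity at `0` of a curve `c` with `c 0 = x`, in the internal tangent space at `x`. -/
def curveVec (x : X) (c : ℝ → X) : IntTangentSpace x :=
  if h : ∃ q : ℝ → X, DSmooth q ∧ q 0 = x ∧ c =ᶠ[𝓝 0] q then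
    pushSmooth h.choose h.choose_spec.1 h.choose_spec.2.1 (1 : ℝ)
  else 0

/-- Shows that the representative chosen in `curveVec` does not matter: any factorisation of the
germ through a pointed plot computes the same vector. -/
lemma PointedPlot.push_ofSmooth {x : X} (p : PointedPlot x) {q : ℝ → X} (hq : DSmooth q)
    (h : q 0 = x) {σ : ℝ → Euc p.dim} (hσ : ContDiff ℝ ∞ σ) (hσ0 : σ 0 = 0)
    (hqp : ∀ᶠ s in 𝓝 0, q s = p.toFun (σ s)) :
    pushSmooth q hq h (1 : ℝ) = p.push (deriv σ 0) := by
  let e := (toEuclidean (E := ℝ))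
  have hes : ∀ᶠ z in 𝓝 (0 : Euc (Module.finrank ℝ ℝ)), q (e.symm z) = p.toFun (σ (e.symm z)) := by
    have : Tendsto e.symm (𝓝 0) (𝓝 0) := by
      simpa using e.symm.continuous.tendsto 0
    exact this.eventually hqp
  have := PointedPlot.push_eq_of_eventuallyEq (PointedPlot.ofSmooth q hq h) p
    (fun z => σ (e.symm z)) (hσ.comp e.symm.contDiff)
    ((congrArg σ (_root_.map_zero e.symm)).trans hσ0) hes (e 1)
  refine this.trans (congrArg _ ?_)
  have hσd : HasFDerivAt σ (fderiv ℝ σ 0) (e.symm 0) := by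
    rw [_root_.map_zero]; exact (hσ.differentiable (by simp) 0).hasFDerivAt
  have hd : HasFDerivAt (fun z => σ (e.symm z))
      ((fderiv ℝ σ 0).comp (e.symm : _ →L[ℝ] ℝ)) 0 :=
    hσd.comp (0 : Euc (Module.finrank ℝ ℝ)) e.symm.hasFDerivAt
  refine (congrArg (fun L => L (e 1)) hd.fderiv).trans ?_
  simp [e]

lemma curveVec_eq_push {x : X} (p : PointedPlot x) {c : ℝ → X} {σ : ℝ → Euc p.dim}
    (hσ : ContDiff ℝ ∞ σ) (hσ0 : σ 0 = 0) (hcp : ∀ᶠ s in 𝓝 0, c s = p.toFun (σ s)) :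
    curveVec x c = p.push (deriv σ 0) := by
  have h : ∃ q : ℝ → X, DSmooth q ∧ q 0 = x ∧ c =ᶠ[𝓝 0] q :=
    ⟨fun s => p.toFun (σ s), p.isPlot.dSmooth.comp hσ.dSmooth,
      (congrArg p.toFun hσ0).trans p.map_zero, hcp⟩
  rw [curveVec, dif_pos h]
  refine p.push_ofSmooth _ _ hσ hσ0 ?_
  filter_upwards [h.choose_spec.2.2, hcp] with s h1 h2
  rw [← h1, h2]

lemma curveVec_eq_pushSmooth {x : X} {q : V → X} (hq : DSmooth q) (h : q 0 = x) {c : ℝ → X}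
    {σ : ℝ → V} (hσ : ContDiff ℝ ∞ σ) (hσ0 : σ 0 = 0) (hcq : ∀ᶠ s in 𝓝 0, c s = q (σ s)) :
    curveVec x c = pushSmooth q hq h (deriv σ 0) := by
  let e := (toEuclidean (E := V))
  refine (curveVec_eq_push (PointedPlot.ofSmooth q hq h) (σ := fun s => e (σ s))
    (e.contDiff.comp hσ) ((congrArg e hσ0).trans (map_zero e)) ?_).trans ?_
  · filter_upwards [hcq] with s hs
    simp [hs, PointedPlot.ofSmooth, e]
  · have hd : HasDerivAt (fun s => e (σ s)) (e (deriv σ 0)) 0 :=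
      e.hasFDerivAt.comp_hasDerivAt (0 : ℝ)
        (hσ.differentiable (by simp) 0).hasDerivAt
    exact congrArg _ hd.deriv

lemma curveVec_congr {x : X} {c d : ℝ → X} (h : c =ᶠ[𝓝 0] d) : curveVec x c = curveVec x d := by
  by_cases hc : ∃ q : ℝ → X, DSmooth q ∧ q 0 = x ∧ c =ᶠ[𝓝 0] q
  · obtain ⟨q, hq, hq0, hcq⟩ := hc
    rw [curveVec_eq_pushSmooth hq hq0 contDiff_id rfl hcq,
      curveVec_eq_pushSmooth hq hq0 contDiff_id rfl (h.symm.trans hcq)]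
  · rw [curveVec, curveVec, dif_neg hc, dif_neg]
    rintro ⟨q, hq, hq0, hdq⟩
    exact hc ⟨q, hq, hq0, h.trans hdq⟩

lemma curveVec_const (x : X) : curveVec x (fun _ => x) = 0 := by
  rw [curveVec_eq_pushSmooth (V := ℝ) (q := fun _ => x) dSmooth_const rfl (σ := fun _ => 0)
    contDiff_const rfl (Eventually.of_forall fun _ => rfl)]
  simp

/-- The chain rule for reparametrisations. -/
lemma curveVec_comp {x : X} {c : ℝ → X} (hc : DSmoothAt c 0) (hx : c 0 = x) {σ : ℝ → ℝ}
    (hσ : DSmoothAt σ 0) (hσ0 : σ 0 = 0) :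
    curveVec x (fun s => c (σ s)) = deriv σ 0 • curveVec x c := by
  obtain ⟨q, hq, hcq⟩ := hc
  have hcσ : ∀ᶠ s in 𝓝 0, c (σ s) = q (σ s) := by
    have := hσ.continuousAt.tendsto
    rw [hσ0] at this
    exact this.eventually hcq
  obtain ⟨τ, hτ, hστ⟩ := hσ
  have hq0 : q 0 = x := by rw [← hcq.eq_of_nhds, hx]
  rw [curveVec_eq_pushSmooth (V := ℝ) hq hq0 contDiff_id rfl hcq,
    curveVec_eq_pushSmooth (V := ℝ) hq hq0 (σ := τ) hτ.contDiff (hστ.eq_of_nhds ▸ hσ0), deriv_id,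
    hστ.deriv_eq, ← map_smul, smul_eq_mul, mul_one]
  filter_upwards [hcσ, hστ] with s h1 h2
  rw [h1, h2]

/-- The velocity of the diagonal of a surface is the sum of the velocities along the axes. -/
lemma curveVec_diag {x : X} {F : ℝ × ℝ → X} (hF : DSmoothAt F (0, 0)) (hx : F (0, 0) = x) :
    curveVec x (fun s => F (s, s)) =
      curveVec x (fun s => F (s, 0)) + curveVec x (fun s => F (0, s)) := by
  obtain ⟨q, hq, hFq⟩ := hF
  have hq0 : q 0 = x := by rw [← hx, hFq.eq_of_nhds]; rfl
  -- The velocity along a ray is linear in its direction, and `(1,1) = (1,0) + (0,1)`.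
  have key : ∀ a : ℝ × ℝ, curveVec x (fun s => F (s • a)) = pushSmooth q hq hq0 a := by
    intro a
    have hd : HasDerivAt (fun s : ℝ => s • a) a 0 := by
      simpa using (hasDerivAt_id (0 : ℝ)).smul_const a
    refine (curveVec_eq_pushSmooth hq hq0 (σ := fun s : ℝ => s • a)
      (contDiff_id.smul contDiff_const) (zero_smul _ _) ?_).trans (by rw [hd.deriv])
    have : Tendsto (fun s : ℝ => s • a) (𝓝 0) (𝓝 (0, 0)) := by
      have := hd.continuousAt.tendsto
      rwa [zero_smul] at this
    exact this.eventually hFq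
  have h1 := key (1, 1)
  have h2 := key (1, 0)
  have h3 := key (0, 1)
  simp only [Prod.smul_mk, smul_eq_mul, mul_one, mul_zero] at h1 h2 h3
  rw [h1, h2, h3, ← map_add]
  simp

/-- The derivative of `f` at `x`, with values in the tangent space at a point `y` equal to `f x`. -/
def tangentMapTo (f : SmoothMap X Y) {x : X} {y : Y} (h : f x = y) :
    IntTangentSpace x →ₗ[ℝ] IntTangentSpace y := h ▸ tangentMapAt f x

lemma tangentMapAt_push (f : SmoothMap X Y) {x : X} (p : PointedPlot x) (v : Euc p.dim) :
    tangentMapAt f x (p.push v) = (p.map f).push v := by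
  classical
  exact DirectSum.toModule_lof (M := fun p : PointedPlot x => Euc p.dim)
    (N := IntTangentSpace (f x)) (φ := fun p => (p.map f).push) ℝ p v

lemma tangentMapTo_curveVec (f : SmoothMap X Y) {x : X} {y : Y} (h : f x = y) {c : ℝ → X}
    (hc : DSmoothAt c 0) (hx : c 0 = x) :
    tangentMapTo f h (curveVec x c) = curveVec y (fun s => f (c s)) := by
  subst h
  obtain ⟨q, hq, hcq⟩ := hc
  have hq0 : q 0 = x := by rw [← hcq.eq_of_nhds, hx]
  let e := (toEuclidean (E := ℝ))
  let p := PointedPlot.ofSmooth q hq hq0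
  have hcp : ∀ᶠ s in 𝓝 0, c s = p.toFun (e s) := by
    filter_upwards [hcq] with s hs
    simp [hs, PointedPlot.ofSmooth, e, p]
  have he0 : e 0 = 0 := map_zero e
  rw [curveVec_eq_push p (σ := e) e.contDiff he0 hcp]
  refine (tangentMapAt_push f p _).trans ?_
  refine (curveVec_eq_push (p.map f) (σ := e) e.contDiff he0 ?_).symm
  filter_upwards [hcp] with s hs
  rw [hs]

lemma plotTangent_eq_curveVec {n : ℕ} (p : Euc n → X) (hp : IsPlot p) (z v : Euc n) {x : X}
    (hx : p z = x) : plotTangent p hp z v = ⟨x, curveVec x (fun s => p (z + s • v))⟩ := by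
  subst hx
  have hd : HasDerivAt (fun s : ℝ => s • v) v 0 := by
    simpa using (hasDerivAt_id (0 : ℝ)).smul_const v
  refine congrArg (IntTangentBundle.mk (p z)) ?_
  refine Eq.trans ?_ (curveVec_eq_push (⟨n, fun y => p (z + y),
    isPlot_reparam hp (contDiff_const.add contDiff_id), by simp⟩ : PointedPlot (p z))
    (σ := fun s : ℝ => s • v) (contDiff_id.smul contDiff_const) (zero_smul _ _)
    (Eventually.of_forall fun _ => rfl)).symm
  exact congrArg _ hd.deriv.symm

/-- Velocities depend smoothly on parameters. -/
lemma dSmooth_curveVec {x : X} {F : V × ℝ → X} (hF : DSmooth F) (hx : ∀ z, F (z, 0) = x) :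
    DSmooth (fun z => curveVec x (fun s => F (z, s))) := by
  intro n b hb
  let e := toEuclidean (E := V × ℝ)
  have hp := dSmooth_iff_isPlot_comp.1 hF
  -- The velocities are values of the tangent map of one plot, taken at the moving base point `(b y,
  -- 0)` in the fixed direction `(0, 1)`; since all feet are `x`, they form a plot of the fibre.
  have := (isTangentDiffeology_tangentBundle (X := X)).plotTangent _ _ hp n
    (fun y => e (b y, 0)) (fun _ => e (0, 1))
    (ContDiff.isPlot (e.contDiff.comp (hb.contDiff.prodMk contDiff_const))) isPlot_const
  have h2 : (fun y => plotTangent _ hp (e (b y, 0)) (e (0, 1))) =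
      fun y => ⟨x, curveVec x (fun s => F (b y, s))⟩ := by
    ext1 y
    rw [plotTangent_eq_curveVec _ hp _ _ (x := x) (by simp [e, hx])]
    simp [← map_smul, ← map_add, e]
  rw [h2] at this
  exact this

/-- Germ version of `dSmooth_curveVec`: a cutoff in the parameter makes the condition on the foot
point hold everywhere. -/
lemma dSmoothAt_curveVec {x : X} {F : V × ℝ → X} {z₀ : V} (hF : DSmoothAt F (z₀, 0))
    (hx : ∀ᶠ z in 𝓝 z₀, F (z, 0) = x) :
    DSmoothAt (fun z => curveVec x (fun s => F (z, s))) z₀ := by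
  obtain ⟨q, hq, hFq⟩ := hF
  have hi : Tendsto (fun z : V => (z, (0 : ℝ))) (𝓝 z₀) (𝓝 (z₀, 0)) :=
    (Continuous.prodMk_left (0 : ℝ)).tendsto z₀
  obtain ⟨β, hβ, hβU, hβz⟩ := exists_smooth_into ((hi.eventually hFq.eventuallyEq_nhds).and hx)
  refine ⟨fun z => curveVec x (fun s => q (β z, s)), dSmooth_curveVec
    (F := fun a => q (β a.1, a.2)) (hq.comp (dSmooth_prodMk (hβ.dSmooth.comp dSmooth_fst)
      dSmooth_snd)) fun z => ?_, ?_⟩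
  · rw [← (hβU z).2, (hβU z).1.eq_of_nhds]
  · filter_upwards [hβz, hi.eventually hFq.eventuallyEq_nhds] with z h1 h2
    rw [h1]
    have hj : Tendsto (fun s : ℝ => (z, s)) (𝓝 0) (𝓝 (z, 0)) :=
      (Continuous.prodMk_right z).tendsto 0
    exact curveVec_congr (hj.eventually h2)

end Velocities

/-! ### Logarithmic derivatives -/

section LogDeriv

variable {G : Type*} [Group G] [DiffeologicalSpace G] [IsDiffeologicalGroup G]

section Algebra

variable {V : Type*} [TopologicalSpace V] [DiffeologicalSpace V]

lemma DSmoothAt.mul {h k : V → G} {x : V} (hh : DSmoothAt h x) (hk : DSmoothAt k x) :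
    DSmoothAt (fun y => h y * k y) x :=
  (hh.prodMk hk).dSmooth_comp IsDiffeologicalGroup.smooth_mul

lemma DSmoothAt.inv {h : V → G} {x : V} (hh : DSmoothAt h x) : DSmoothAt (fun y => (h y)⁻¹) x :=
  hh.dSmooth_comp IsDiffeologicalGroup.smooth_inv

end Algebra

variable {V : Type*} [NormedAddCommGroup V] [NormedSpace ℝ V] [FiniteDimensional ℝ V]
variable [DiffeologicalSpace V] [IsContDiffCompatible V]

/-- Conjugation. -/
def conjMap (g : G) : SmoothMap G G where
  toFun h := g * h * g⁻¹
  smooth := IsDiffeologicalGroup.smooth_mul.comp (dSmooth_prodMk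
    (IsDiffeologicalGroup.smooth_mul.comp (dSmooth_prodMk dSmooth_const dSmooth_id'))
    dSmooth_const)

/-- The adjoint action. -/
def adjointMap (g : G) : IntTangentSpace (1 : G) →ₗ[ℝ] IntTangentSpace (1 : G) :=
  tangentMapTo (conjMap g) (show g * 1 * g⁻¹ = 1 by simp)

/-- The right logarithmic derivative `(R_{k(t)⁻¹})_* k'(t)`. -/
def logDeriv (k : ℝ → G) (t : ℝ) : IntTangentSpace (1 : G) :=
  curveVec 1 (fun s => k (t + s) * (k t)⁻¹)

omit [IsDiffeologicalGroup G] in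
lemma logDeriv_congr {k l : ℝ → G} {t : ℝ} (h : k =ᶠ[𝓝 t] l) : logDeriv k t = logDeriv l t := by
  refine curveVec_congr ?_
  have : Tendsto (fun s : ℝ => t + s) (𝓝 0) (𝓝 t) := by
    simpa using (continuous_const_add t).tendsto 0
  filter_upwards [this.eventually h] with s hs
  rw [hs, h.eq_of_nhds]

omit [IsDiffeologicalGroup G] in
lemma logDeriv_const (g : G) (t : ℝ) : logDeriv (fun _ => g) t = 0 := by
  simp only [logDeriv, mul_inv_cancel]
  exact curveVec_const 1

omit [Group G] [DiffeologicalSpace G] [IsDiffeologicalGroup G] in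
lemma DSmoothAt.translate {X : Type*} [DiffeologicalSpace X] {k : ℝ → X} {t : ℝ}
    (hk : DSmoothAt k t) : DSmoothAt (fun s => k (t + s)) 0 :=
  hk.comp_of_eq ((contDiff_const.add contDiff_id).dSmoothAt 0) (add_zero t)

/-- The product rule. -/
lemma logDeriv_mul {h k : ℝ → G} {t : ℝ} (hh : DSmoothAt h t) (hk : DSmoothAt k t) :
    logDeriv (fun r => h r * k r) t = logDeriv h t + adjointMap (h t) (logDeriv k t) := by
  -- Moving the two factors independently gives a surface through `1`. Its first axis is the curve
  -- of `δh`, its second axis is the curve of `δk` conjugated by `h t`.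
  let F : ℝ × ℝ → G := fun a => h (t + a.1) * (k (t + a.2) * (k t)⁻¹) * (h t)⁻¹
  have hF : DSmoothAt F (0, 0) := by
    refine (DSmoothAt.mul (DSmoothAt.comp_of_eq hh.translate
      (contDiff_fst.dSmoothAt _) rfl) (DSmoothAt.mul (DSmoothAt.comp_of_eq hk.translate
      (contDiff_snd.dSmoothAt _) rfl) (dSmoothAt_const _ _))).mul (dSmoothAt_const _ _)
  have hd := curveVec_diag hF (x := 1) (by simp [F])
  have e1 : (fun s => F (s, s)) = fun s => h (t + s) * k (t + s) * (h t * k t)⁻¹ := by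
    ext s; simp [F, mul_assoc]
  have e2 : (fun s => F (s, 0)) = fun s => h (t + s) * (h t)⁻¹ := by
    ext s; simp [F]
  rw [e1, e2] at hd
  refine hd.trans (congrArg _ ?_)
  refine Eq.trans ?_ (tangentMapTo_curveVec (conjMap (h t)) _
    (hk.translate.mul (dSmoothAt_const _ _)) (by simp)).symm
  congr 1
  ext s
  simp [F, conjMap]

lemma logDeriv_mul_const {k : ℝ → G} {t : ℝ} (hk : DSmoothAt k t) (g : G) :
    logDeriv (fun r => k r * g) t = logDeriv k t := by
  rw [logDeriv_mul hk (dSmoothAt_const _ _), logDeriv_const, map_zero, add_zero]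

/-- The chain rule. -/
lemma logDeriv_comp {k : ℝ → G} {f : ℝ → ℝ} {t : ℝ} (hk : DSmoothAt k (f t))
    (hf : DSmoothAt f t) : logDeriv (fun r => k (f r)) t = deriv f t • logDeriv k (f t) := by
  -- Both curve and reparametrisation are shifted to base time 0, where `curveVec_comp` applies.
  have hσ : DSmoothAt (fun s => f (t + s) - f t) 0 :=
    hf.translate.dSmooth_comp (contDiff_id.sub contDiff_const).dSmooth
  have := curveVec_comp (c := fun s => k (f t + s) * (k (f t))⁻¹) (x := 1)
    (hk.translate.mul (dSmoothAt_const _ _)) (by simp) hσ (by simp)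
  have hd : deriv (fun s => f (t + s) - f t) 0 = deriv f t := by
    rw [deriv_sub_const, deriv_comp_const_add, add_zero]
  rw [hd] at this
  simpa only [logDeriv, add_sub_cancel] using this

/-- Logarithmic derivatives depend smoothly on the time and on parameters. -/
lemma dSmoothAt_logDeriv {F : V × ℝ → G} {a : V × ℝ} (hF : DSmoothAt F a) :
    DSmoothAt (fun b : V × ℝ => logDeriv (fun r => F (b.1, r)) b.2) a := by
  refine dSmoothAt_curveVec (V := V × ℝ)
    (F := fun c : (V × ℝ) × ℝ => F (c.1.1, c.1.2 + c.2) * (F (c.1.1, c.1.2))⁻¹) ?_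
    (Eventually.of_forall fun b => by simp)
  refine DSmoothAt.mul (hF.comp_of_eq (ContDiff.dSmoothAt ?_ _) (by simp))
    (DSmoothAt.inv (hF.comp_of_eq (ContDiff.dSmoothAt ?_ _) (by simp)))
  · fun_prop
  · fun_prop

/-- The parametrised statement with a dummy real parameter, frozen at 0. -/
lemma DSmoothAt.logDeriv {k : ℝ → G} {t : ℝ} (hk : DSmoothAt k t) :
    DSmoothAt (DiffBundle.logDeriv k) t :=
  (dSmoothAt_logDeriv (F := fun b : ℝ × ℝ => k b.2) (a := (0, t))
    (DSmoothAt.comp_of_eq hk (contDiff_snd.dSmoothAt _) rfl)).comp_of_eq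
    (g := fun s : ℝ => ((0 : ℝ), s)) ((contDiff_const.prodMk contDiff_id).dSmoothAt t) rfl

/-! ### Evolutions -/

/-- The constant extension of a map on `[0,1]`. -/
abbrev unitExtend {Y : Type*} (g : Icc (0 : ℝ) 1 → Y) : ℝ → Y := IccExtend zero_le_one g

/-- Restricted to interior times: the constant extension usually has a corner at 0 and 1. -/
lemma dSmoothAt_unitExtend {Y : Type*} [DiffeologicalSpace Y] {g : Icc (0 : ℝ) 1 → Y}
    (hg : DSmooth g) {t : ℝ} (ht : t ∈ Ioo (0 : ℝ) 1) : DSmoothAt (unitExtend g) t := by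
  refine DSmoothOn.dSmoothAt (s := Ioo 0 1) (fun n p hp hs => ?_) (isOpen_Ioo.mem_nhds ht)
  refine hg n (fun z => projIcc 0 1 zero_le_one (p z)) ?_
  have : (fun z => (projIcc (0 : ℝ) 1 zero_le_one (p z) : ℝ)) = p := by
    ext z; rw [projIcc_of_mem zero_le_one (Ioo_subset_Icc_self (hs z))]
  show IsPlot (fun z => (projIcc (0 : ℝ) 1 zero_le_one (p z) : ℝ))
  rwa [this]

omit [IsDiffeologicalGroup G] in
lemma velocity_eq {X : Type*} [DiffeologicalSpace X] (c : SmoothMap ℝ X) (t : ℝ) :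
    velocity c t = ⟨c t, curveVec (c t) (fun s => c (t + s))⟩ := by
  rw [velocity, plotTangent_eq_curveVec _ _ _ _ (x := c t) (by simp)]
  simp

/-- The bridge from the bundle-valued equation in `IsEvolution` to vectors in the single space `T_e
G`. -/
lemma tangentMap_rightMul_velocity (c : SmoothMap ℝ G) (t : ℝ) :
    tangentMap (rightMul (c t)⁻¹) (velocity c t) = ⟨1, logDeriv c t⟩ := by
  have key : ∀ {x y : G} (f : SmoothMap G G) (h : f x = y) (v : IntTangentSpace x),
      tangentMap f ⟨x, v⟩ = ⟨y, tangentMapTo f h v⟩ := by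
    rintro x _ f rfl v; rfl
  have h1 : rightMul (c t)⁻¹ (c t) = 1 := mul_inv_cancel (c t)
  rw [velocity_eq, key _ h1]
  exact congrArg (IntTangentBundle.mk (1 : G)) (tangentMapTo_curveVec (rightMul (c t)⁻¹) h1
    (DSmoothAt.translate (c.smooth.dSmoothAt t)) (by simp))

/-- The evolution equation in terms of logarithmic derivatives. -/
lemma isEvolution_iff {ξ : SmoothMap (Icc (0 : ℝ) 1) (IntTangentSpace (1 : G))}
    {g : SmoothMap (Icc (0 : ℝ) 1) G} : IsEvolution ξ g ↔
      g ⟨0, by simp⟩ = 1 ∧ ∀ t ∈ Ioo (0 : ℝ) 1, logDeriv (unitExtend g) t = unitExtend ξ t := by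
  have key : ∀ (t : ℝ) (ht : t ∈ Ioo (0 : ℝ) 1) (q : SmoothMap ℝ G),
      (∀ᶠ s in 𝓝 t, ∃ h : s ∈ Icc (0 : ℝ) 1, q s = g ⟨s, h⟩) →
      tangentMap (rightMul (g ⟨t, Ioo_subset_Icc_self ht⟩)⁻¹) (velocity q t) =
        ⟨1, logDeriv (unitExtend g) t⟩ := by
    intro t ht q hq
    obtain ⟨_, h⟩ := hq.self_of_nhds
    rw [← h, tangentMap_rightMul_velocity, logDeriv_congr]
    filter_upwards [hq] with s hs
    obtain ⟨h1, h2⟩ := hs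
    rw [h2, unitExtend, IccExtend_of_mem _ _ h1]
  refine ⟨fun h => ⟨h.init, fun t ht => ?_⟩, fun h => ⟨h.1, fun t ht => ?_⟩⟩
  · obtain ⟨a, ⟨q, hq, rfl⟩, ha⟩ := h.eqn t ht
    rw [key t ht q hq, IntTangentBundle.mk.injEq] at ha
    rw [eq_of_heq ha.2, unitExtend, IccExtend_of_mem _ _ (Ioo_subset_Icc_self ht)]
  · obtain ⟨q, hq, hgq⟩ := dSmoothAt_unitExtend g.smooth ht
    have hq' : ∀ᶠ s in 𝓝 t, ∃ h : s ∈ Icc (0 : ℝ) 1, (⟨q, hq⟩ : SmoothMap ℝ G) s = g ⟨s, h⟩ := by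
      filter_upwards [hgq, isOpen_Ioo.mem_nhds ht] with s h1 h2
      refine ⟨Ioo_subset_Icc_self h2, ?_⟩
      show q s = _
      rw [← h1, unitExtend, IccExtend_of_mem _ _ (Ioo_subset_Icc_self h2)]
    refine ⟨_, ⟨⟨q, hq⟩, hq', rfl⟩, ?_⟩
    rw [key t ht _ hq', h.2 t ht, unitExtend, IccExtend_of_mem _ _ (Ioo_subset_Icc_self ht)]

end LogDeriv

/-! ### The evolution equation on open intervals -/

section Solve

variable {G : Type*} [Group G] [DiffeologicalSpace G] [IsDiffeologicalGroup G]
variable {V : Type*} [NormedAddCommGroup V] [NormedSpace ℝ V] [FiniteDimensional ℝ V]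
variable [DiffeologicalSpace V] [IsContDiffCompatible V]

/-- The exponential map of a regular diffeological group. -/
structure IsEvolutionMap
    (ex : SmoothMap (Icc (0 : ℝ) 1) (IntTangentSpace (1 : G)) → SmoothMap (Icc (0 : ℝ) 1) G) :
    Prop where
  smooth : DSmooth ex
  isEvolution : ∀ ξ, IsEvolution ξ (ex ξ)
  eq_of_isEvolution : ∀ ξ g, IsEvolution ξ g → g = ex ξ

open Classical in
/-- The smooth map with a given underlying map (or zero, if that is not smooth). -/
def smoothMapOfFun {Y : Type*} [DiffeologicalSpace Y] (f : Y → IntTangentSpace (1 : G)) :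
    SmoothMap Y (IntTangentSpace (1 : G)) :=
  if h : DSmooth f then ⟨f, h⟩ else ⟨fun _ => 0, dSmooth_const⟩

/-- The path `s ↦ (b - a) η(a + s (b - a))` on `[0,1]`. -/
def segmentPath (η : ℝ → IntTangentSpace (1 : G)) (a b : ℝ) :
    SmoothMap (Icc (0 : ℝ) 1) (IntTangentSpace (1 : G)) :=
  smoothMapOfFun fun s : Icc (0 : ℝ) 1 => (b - a) • η (a + s * (b - a))

/-- The value at `b` of the solution with initial value `1` at `a` of `logDeriv u = η`. -/
def solve (ex : SmoothMap (Icc (0 : ℝ) 1) (IntTangentSpace (1 : G)) → SmoothMap (Icc (0 : ℝ) 1) G)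
    (η : ℝ → IntTangentSpace (1 : G)) (a b : ℝ) : G :=
  ex (segmentPath η a b) ⟨1, by simp⟩

variable {ex : SmoothMap (Icc (0 : ℝ) 1) (IntTangentSpace (1 : G)) → SmoothMap (Icc (0 : ℝ) 1) G}

omit [IsDiffeologicalGroup G] in
lemma segmentPath_apply {η : ℝ → IntTangentSpace (1 : G)} {a b : ℝ}
    (h : DSmooth (fun s : Icc (0 : ℝ) 1 => (b - a) • η (a + s * (b - a)))) (s : Icc (0 : ℝ) 1) :
    segmentPath η a b s = (b - a) • η (a + s * (b - a)) := by
  rw [segmentPath, smoothMapOfFun, dif_pos h]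

lemma dSmooth_eval {Y Z : Type*} [DiffeologicalSpace Y] [DiffeologicalSpace Z] (y : Y) :
    DSmooth (fun g : SmoothMap Y Z => g y) := fun n _ hp =>
  hp n (fun z => (z, y)) ⟨isPlot_id, isPlot_const⟩

omit [IsDiffeologicalGroup G] in
-- Joint smoothness makes the segment paths a plot of the functional diffeology; then `ex` is
-- smooth, and so is evaluation at 1.
lemma dSmooth_solve (hex : DSmooth ex) {Z : Type*} [DiffeologicalSpace Z]
    {η : Z → ℝ → IntTangentSpace (1 : G)} {a b : Z → ℝ}
    (h : DSmooth (fun w : Z × Icc (0 : ℝ) 1 =>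
      (b w.1 - a w.1) • η w.1 (a w.1 + w.2 * (b w.1 - a w.1)))) :
    DSmooth (fun z => solve ex (η z) (a z) (b z)) := by
  refine ((dSmooth_eval _).comp hex).comp (f := fun z => segmentPath (η z) (a z) (b z)) ?_
  intro n p hp
  show DSmooth (fun w : Euc n × Icc (0 : ℝ) 1 => segmentPath (η (p w.1)) (a (p w.1)) (b (p w.1)) w.2)
  have e : (fun w : Euc n × Icc (0 : ℝ) 1 =>
      segmentPath (η (p w.1)) (a (p w.1)) (b (p w.1)) w.2) = fun w =>
      (b (p w.1) - a (p w.1)) • η (p w.1) (a (p w.1) + w.2 * (b (p w.1) - a (p w.1))) := by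
    ext w
    exact segmentPath_apply (h.comp (dSmooth_prodMk (dSmooth_const (y := p w.1)) dSmooth_id')) w.2
  rw [e]
  exact h.comp (f := fun w : Euc n × Icc (0 : ℝ) 1 => (p w.1, w.2))
    (dSmooth_prodMk (hp.dSmooth.comp dSmooth_fst) dSmooth_snd)

omit [IsDiffeologicalGroup G] in
/-- The solution depends smoothly on all data. -/
lemma dSmoothAt_solve (hex : DSmooth ex) {η : V → ℝ → IntTangentSpace (1 : G)} {a b : V → ℝ}
    {z₀ : V} (ha : DSmoothAt a z₀) (hb : DSmoothAt b z₀)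
    (hη : ∀ᶠ z in 𝓝 z₀, ∀ s ∈ Icc (0 : ℝ) 1,
      DSmoothAt (fun w : V × ℝ => η w.1 w.2) (z, a z + s * (b z - a z))) :
    DSmoothAt (fun z => solve ex (η z) (a z) (b z)) z₀ := by
  -- All hypotheses persist near `z₀`, and along a plot staying in that set the global statement
  -- `dSmooth_solve` applies.
  refine DSmoothOn.dSmoothAt (s := {z | DSmoothAt a z ∧ DSmoothAt b z ∧ ∀ s ∈ Icc (0 : ℝ) 1,
    DSmoothAt (fun w : V × ℝ => η w.1 w.2) (z, a z + s * (b z - a z))}) (fun n p hp hs => ?_)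
    (ha.eventually.and (hb.eventually.and hη))
  refine DSmooth.isPlot (dSmooth_solve hex fun m w hw => isPlot_of_dSmoothAt fun y => ?_)
  obtain ⟨h1, h2, h3⟩ := hs (w y).1
  have hp' : DSmoothAt (fun y => p (w y).1) y := (hp.dSmooth.comp hw.1.dSmooth).dSmoothAt y
  have ha' : DSmoothAt (fun y => a (p (w y).1)) y := h1.comp (g := fun y => p (w y).1) hp'
  have hb' : DSmoothAt (fun y => b (p (w y).1)) y := h2.comp (g := fun y => p (w y).1) hp'
  have hw2 : IsPlot (fun y => ((w y).2 : ℝ)) := hw.2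
  have hs' : DSmoothAt (fun y => ((w y).2 : ℝ)) y := hw2.dSmooth.dSmoothAt y
  have hba : DSmoothAt (fun y => b (p (w y).1) - a (p (w y).1)) y :=
    (hb'.prodMk ha').dSmooth_comp (g := fun c : ℝ × ℝ => c.1 - c.2)
      (contDiff_fst.sub contDiff_snd).dSmooth
  refine (hba.prodMk ((h3 _ (w y).2.2).comp_of_eq (g := fun y => (p (w y).1,
    a (p (w y).1) + (w y).2 * (b (p (w y).1) - a (p (w y).1)))) (hp'.prodMk ?_) rfl)).dSmooth_comp
    (dSmooth_tangentSpace_smul 1)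
  exact (ha'.prodMk (hs'.prodMk hba)).dSmooth_comp (g := fun c : ℝ × ℝ × ℝ => c.1 + c.2.1 * c.2.2)
    (ContDiff.dSmooth (by fun_prop))

variable {I : Set ℝ} {η : ℝ → IntTangentSpace (1 : G)} {a b : ℝ}

lemma segment_mem (hI : I.OrdConnected) (ha : a ∈ I) (hb : b ∈ I) {s : ℝ}
    (hs : s ∈ Icc (0 : ℝ) 1) : a + s * (b - a) ∈ I := by
  simpa using hI.convex.add_smul_sub_mem ha hb hs

lemma dSmoothAt_segment (a b s : ℝ) : DSmoothAt (fun s => a + s * (b - a)) s :=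
  ContDiff.dSmoothAt (by fun_prop) s

lemma deriv_segment (a b s : ℝ) : deriv (fun s => a + s * (b - a)) s = b - a := by
  simp

omit [Group G] [DiffeologicalSpace G] [IsDiffeologicalGroup G] in
lemma dSmooth_comp_segment {Y : Type*} [DiffeologicalSpace Y] {u : ℝ → Y} (hI : I.OrdConnected)
    (hu : ∀ t ∈ I, DSmoothAt u t) (ha : a ∈ I) (hb : b ∈ I) :
    DSmooth (fun s : Icc (0 : ℝ) 1 => u (a + s * (b - a))) := by
  intro n p hp
  have hp' : IsPlot (fun z => (p z : ℝ)) := hp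
  exact isPlot_of_dSmoothAt fun z => (hu _ (segment_mem hI ha hb (p z).2)).comp_of_eq
    (g := fun z => a + p z * (b - a)) ((dSmoothAt_segment a b (p z)).comp
      (g := fun z => (p z : ℝ)) (hp'.dSmooth.dSmoothAt z)) rfl

omit [IsDiffeologicalGroup G] in
lemma segmentPath_apply_of_mem (hI : I.OrdConnected) (hη : ∀ t ∈ I, DSmoothAt η t)
    (ha : a ∈ I) (hb : b ∈ I) (s : Icc (0 : ℝ) 1) :
    segmentPath η a b s = (b - a) • η (a + s * (b - a)) :=
  segmentPath_apply ((dSmooth_tangentSpace_smul 1).comp (f := fun s : Icc (0 : ℝ) 1 =>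
    (b - a, η (a + s * (b - a)))) (dSmooth_prodMk dSmooth_const
      (dSmooth_comp_segment hI hη ha hb))) s

/-- Uniqueness of solutions. -/
lemma eq_solve (hex : IsEvolutionMap ex) (hI : I.OrdConnected) (hη : ∀ t ∈ I, DSmoothAt η t)
    (ha : a ∈ I) {u : ℝ → G} (hu : ∀ t ∈ I, DSmoothAt u t) (hu' : ∀ t ∈ I, logDeriv u t = η t)
    (hua : u a = 1) (hb : b ∈ I) : u b = solve ex η a b := by
  -- Pulling `u` back to `[0,1]` multiplies its logarithmic derivative by `b - a`, the factor built
  -- into `segmentPath`. No order between `a` and `b` is needed.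
  let g : SmoothMap (Icc (0 : ℝ) 1) G := ⟨_, dSmooth_comp_segment hI hu ha hb⟩
  have hg : IsEvolution (segmentPath η a b) g := by
    refine isEvolution_iff.2 ⟨by simpa [g] using hua, fun t ht => ?_⟩
    have hm := segment_mem hI ha hb (Ioo_subset_Icc_self ht)
    rw [unitExtend, unitExtend, IccExtend_of_mem _ _ (Ioo_subset_Icc_self ht),
      segmentPath_apply_of_mem hI hη ha hb, ← hu' _ hm]
    have e : IccExtend zero_le_one g.toFun =ᶠ[𝓝 t] fun s => u (a + s * (b - a)) := by
      filter_upwards [isOpen_Ioo.mem_nhds ht] with s hs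
      rw [IccExtend_of_mem _ _ (Ioo_subset_Icc_self hs)]
    rw [logDeriv_congr e, logDeriv_comp (f := fun s => a + s * (b - a)) (hu _ hm)
      (dSmoothAt_segment a b t), deriv_segment]
  have := congrArg (fun h : SmoothMap (Icc (0 : ℝ) 1) G => h ⟨1, by simp⟩)
    (hex.eq_of_isEvolution _ _ hg)
  simpa [g, solve] using this

/-- The exponential along a segment consists of the solutions on shorter segments. -/
lemma ex_segmentPath (hex : IsEvolutionMap ex) (hI : I.OrdConnected)
    (hη : ∀ t ∈ I, DSmoothAt η t) (ha : a ∈ I) (hb : b ∈ I) (s : Icc (0 : ℝ) 1) :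
    ex (segmentPath η a b) s = solve ex η a (a + s * (b - a)) := by
  have hmul : ∀ r : Icc (0 : ℝ) 1, (s * r : ℝ) ∈ Icc (0 : ℝ) 1 := fun r =>
    ⟨mul_nonneg s.2.1 r.2.1, mul_le_one₀ s.2.2 r.2.1 r.2.2⟩
  have hsm : DSmooth (fun r : Icc (0 : ℝ) 1 => (⟨s * r, hmul r⟩ : Icc (0 : ℝ) 1)) := by
    intro n p hp
    have hp' : IsPlot (fun z => (p z : ℝ)) := hp
    exact ContDiff.isPlot (p := fun z => (s * p z : ℝ)) (contDiff_const.mul hp'.contDiff)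
  -- Slowing the long evolution down by `s` gives the evolution of the shorter segment, by
  -- uniqueness.
  let g : SmoothMap (Icc (0 : ℝ) 1) G := ⟨fun r => ex (segmentPath η a b) ⟨s * r, hmul r⟩,
    (ex (segmentPath η a b)).smooth.comp hsm⟩
  obtain ⟨h0, h1⟩ := isEvolution_iff.1 (hex.isEvolution (segmentPath η a b))
  have hb' : a + s * (b - a) ∈ I := segment_mem hI ha hb s.2
  have hg : IsEvolution (segmentPath η a (a + s * (b - a))) g := by
    refine isEvolution_iff.2 ⟨by simpa [g] using h0, fun t ht => ?_⟩
    rw [unitExtend, unitExtend, IccExtend_of_mem _ _ (Ioo_subset_Icc_self ht),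
      segmentPath_apply_of_mem hI hη ha hb']
    have e : IccExtend zero_le_one g.toFun =ᶠ[𝓝 t]
        fun r => unitExtend (ex (segmentPath η a b)) (s * r) := by
      filter_upwards [isOpen_Ioo.mem_nhds ht] with r hr
      rw [IccExtend_of_mem _ _ (Ioo_subset_Icc_self hr), unitExtend,
        IccExtend_of_mem _ _ (hmul ⟨r, Ioo_subset_Icc_self hr⟩)]
    rw [logDeriv_congr e]
    -- For `s = 0` the time `s * t` is not interior, but curve and segment are both constant.
    rcases s.2.1.eq_or_lt with hs | hs
    · simp [← hs, logDeriv_const]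
    · have hst : (s * t : ℝ) ∈ Ioo (0 : ℝ) 1 :=
        ⟨mul_pos hs ht.1, (mul_le_of_le_one_left ht.1.le s.2.2).trans_lt ht.2⟩
      rw [logDeriv_comp (f := fun r => (s : ℝ) * r) (dSmoothAt_unitExtend (ex _).smooth hst)
        (ContDiff.dSmoothAt (by fun_prop) t), h1 _ hst, unitExtend,
        IccExtend_of_mem _ _ (Ioo_subset_Icc_self hst), segmentPath_apply_of_mem hI hη ha hb,
        smul_smul]
      have : deriv (fun r => (s : ℝ) * r) t = s := by
        rw [deriv_const_mul _ differentiableAt_id]; simp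
      rw [this]
      congr 2 <;> ring_nf
  have := congrArg (fun h : SmoothMap (Icc (0 : ℝ) 1) G => h ⟨1, by simp⟩)
    (hex.eq_of_isEvolution _ _ hg)
  simpa [g, solve] using this

lemma solve_self (hex : IsEvolutionMap ex) (hI : I.OrdConnected) (hη : ∀ t ∈ I, DSmoothAt η t)
    (ha : a ∈ I) : solve ex η a a = 1 := by
  have h := ex_segmentPath hex hI hη ha ha ⟨0, by simp⟩
  rw [(hex.isEvolution _).init] at h
  simpa using h.symm

lemma dSmoothAt_solve_right (hex : IsEvolutionMap ex) (hI : I.OrdConnected) (hIo : IsOpen I)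
    (hη : ∀ t ∈ I, DSmoothAt η t) (ha : a ∈ I) {t : ℝ} (ht : t ∈ I) :
    DSmoothAt (solve ex η a) t := by
  refine dSmoothAt_solve (V := ℝ) (η := fun _ => η) (a := fun _ => a) (b := fun t => t) hex.smooth
    (dSmoothAt_const _ _) (dSmooth_id'.dSmoothAt t) ?_
  filter_upwards [hIo.mem_nhds ht] with z hz s hs
  exact (hη _ (segment_mem hI ha hz hs)).comp_of_eq (contDiff_snd.dSmoothAt _) rfl

/-- The equation holds only at interior parameters, so the segment from `a` is prolonged a little
beyond `t`; this puts `t` at parameter `1 / (1 + δ) < 1`. For `t = a` the segment would be a point.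
-/
lemma logDeriv_solve_of_ne (hex : IsEvolutionMap ex) (hI : I.OrdConnected) (hIo : IsOpen I)
    (hη : ∀ t ∈ I, DSmoothAt η t) (ha : a ∈ I) {t : ℝ} (ht : t ∈ I) (hta : t ≠ a) :
    logDeriv (solve ex η a) t = η t := by
  obtain ⟨δ, hδ, hδI⟩ : ∃ δ : ℝ, 0 < δ ∧ t + δ * (t - a) ∈ I := by
    have hc : Tendsto (fun δ : ℝ => t + δ * (t - a)) (𝓝[>] 0) (𝓝 t) := by
      have : Continuous (fun δ : ℝ => t + δ * (t - a)) := by fun_prop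
      simpa using (this.tendsto 0).mono_left nhdsWithin_le_nhds
    obtain ⟨δ, h1, h2⟩ := ((hc.eventually (hIo.mem_nhds ht)).and self_mem_nhdsWithin).exists
    exact ⟨δ, h2, h1⟩
  set b := t + δ * (t - a) with hb
  have hba : b - a = (1 + δ) * (t - a) := by rw [hb]; ring
  have hta' : t - a ≠ 0 := sub_ne_zero.2 hta
  have hba0 : b - a ≠ 0 := by rw [hba]; positivity
  let σ : ℝ → ℝ := fun r => (r - a) / (b - a)
  have hσc : ContDiff ℝ ∞ σ := by fun_prop
  have hσt : σ t ∈ Ioo (0 : ℝ) 1 := by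
    have : σ t = 1 / (1 + δ) := by simp only [σ, hba]; field_simp
    rw [this]
    exact ⟨by positivity, by rw [div_lt_one (by positivity)]; linarith⟩
  have hσ' : deriv σ t = 1 / (b - a) := by simp [σ]
  have hseg : ∀ r, a + σ r * (b - a) = r := fun r => by simp only [σ]; field_simp; ring
  have e : solve ex η a =ᶠ[𝓝 t] fun r => unitExtend (ex (segmentPath η a b)) (σ r) := by
    filter_upwards [hσc.continuous.continuousAt.eventually (isOpen_Ioo.mem_nhds hσt)] with r hr
    rw [unitExtend, IccExtend_of_mem _ _ (Ioo_subset_Icc_self hr),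
      ex_segmentPath hex hI hη ha hδI, hseg]
  rw [logDeriv_congr e, logDeriv_comp (dSmoothAt_unitExtend (ex _).smooth hσt) (hσc.dSmoothAt t),
    (isEvolution_iff.1 (hex.isEvolution _)).2 _ hσt, unitExtend,
    IccExtend_of_mem _ _ (Ioo_subset_Icc_self hσt), segmentPath_apply_of_mem hI hη ha hδI, hσ',
    smul_smul, hseg, one_div, inv_mul_cancel₀ hba0, one_smul]

/-- Smooth linear functionals separate points, so continuity determines the derivative at the
initial time. -/
lemma logDeriv_solve (hLie : IsDiffeologicalLieGroup G) (hex : IsEvolutionMap ex)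
    (hI : I.OrdConnected) (hIo : IsOpen I) (hη : ∀ t ∈ I, DSmoothAt η t) (ha : a ∈ I) {t : ℝ}
    (ht : t ∈ I) : logDeriv (solve ex η a) t = η t := by
  by_cases hta : t = a
  · subst hta
    by_contra hne
    obtain ⟨l, hl, hl0⟩ := hLie.separating _ (sub_ne_zero.2 hne)
    refine hl0 ?_
    rw [map_sub, sub_eq_zero]
    have h1 : ContinuousAt (fun r => l (logDeriv (solve ex η t) r)) t :=
      ((dSmoothAt_solve_right hex hI hIo hη ht ht).logDeriv.dSmooth_comp hl).continuousAt
    have h2 : ContinuousAt (fun r => l (η r)) t := ((hη t ht).dSmooth_comp hl).continuousAt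
    refine tendsto_nhds_unique (f := fun r => l (η r)) (l := 𝓝[≠] t)
      ((h1.tendsto.mono_left nhdsWithin_le_nhds).congr' ?_)
      (h2.tendsto.mono_left nhdsWithin_le_nhds)
    filter_upwards [self_mem_nhdsWithin, mem_nhdsWithin_of_mem_nhds (hIo.mem_nhds ht)] with r h3 h4
    rw [logDeriv_solve_of_ne hex hI hIo hη ht h4 h3]
  · exact logDeriv_solve_of_ne hex hI hIo hη ha ht hta

/-- Curves with vanishing logarithmic derivative are constant. -/
lemma eq_of_logDeriv_eq_zero (hex : IsEvolutionMap ex) (hI : I.OrdConnected) {u : ℝ → G}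
    (hu : ∀ t ∈ I, DSmoothAt u t) (hu' : ∀ t ∈ I, logDeriv u t = 0) (ha : a ∈ I) (hb : b ∈ I) :
    u b = u a := by
  have h0 : ∀ t ∈ I, DSmoothAt (fun _ : ℝ => (0 : IntTangentSpace (1 : G))) t :=
    fun t _ => dSmoothAt_const _ t
  -- The normalised curve and the constant 1 solve the same equation with zero right-hand side.
  have h1 := eq_solve hex hI h0 ha (u := fun t => u t * (u a)⁻¹)
    (fun t ht => (hu t ht).mul (dSmoothAt_const _ _))
    (fun t ht => by rw [logDeriv_mul_const (hu t ht), hu' t ht]) (by simp) hb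
  have h2 := eq_solve hex hI h0 ha (u := fun _ => (1 : G)) (fun t _ => dSmoothAt_const _ t)
    (fun t _ => logDeriv_const 1 t) rfl hb
  exact mul_inv_eq_one.1 (h1.trans h2.symm)

end Solve

/-! ### Locally finite smooth partitions of unity -/

section Partition

variable {X : Type*} [DiffeologicalSpace X]

/-- Near every point, all but finitely many members of the sequence vanish. -/
def IsLocallyFiniteSeq {M : Type*} [Zero M] (f : ℕ → X → M) : Prop :=
  ∀ x, ∃ (N : Set X) (m : ℕ), IsOpen[dTopology] N ∧ x ∈ N ∧ ∀ i ≥ m, ∀ y ∈ N, f i y = 0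

lemma _root_.Diffeology.DSmooth.isOpen_preimage_real {f : X → ℝ} (hf : DSmooth f) {O : Set ℝ}
    (hO : IsOpen O) : IsOpen[dTopology] (f ⁻¹' O) :=
  isOpen_iff_preimages_plots.2 fun n p hp =>
    hO.preimage (IsPlot.contDiff (hf n p hp)).continuous

lemma finsum_eq_sum_range {M : Type*} [AddCommMonoid M] {f : ℕ → M} {m : ℕ}
    (h : ∀ i ≥ m, f i = 0) : ∑ᶠ i, f i = ∑ i ∈ Finset.range m, f i := by
  refine finsum_eq_sum_of_support_subset _ fun i hi => ?_
  simp only [Finset.coe_range, mem_Iio]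
  by_contra hm
  exact hi (h i (not_lt.1 hm))

lemma dSmooth_sum {ι : Type*} {f : ι → X → ℝ} (hf : ∀ i, DSmooth (f i)) (s : Finset ι) :
    DSmooth (fun x => ∑ i ∈ s, f i x) := fun n p hp =>
  ContDiff.isPlot (ContDiff.sum fun i _ => IsPlot.contDiff (hf i n p hp))

lemma IsLocallyFiniteSeq.dSmooth_finsum {f : ℕ → X → ℝ} (hl : IsLocallyFiniteSeq f)
    (hf : ∀ i, DSmooth (f i)) : DSmooth (fun x => ∑ᶠ i, f i x) := by
  intro n p hp
  refine isPlot_of_dSmoothAt fun z => ?_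
  obtain ⟨N, m, hN, hz, h⟩ := hl (p z)
  refine (((dSmooth_sum hf (Finset.range m)).comp hp.dSmooth).dSmoothAt z).congr ?_
  filter_upwards [(hp.dSmooth.isOpen_preimage hN).mem_nhds hz] with y hy
  exact finsum_eq_sum_range fun i hi => h i hi _ hy

lemma dSmooth_div {f g : X → ℝ} (hf : DSmooth f) (hg : DSmooth g) (h0 : ∀ x, g x ≠ 0) :
    DSmooth (fun x => f x / g x) := fun n p hp =>
  ContDiff.isPlot ((IsPlot.contDiff (hf n p hp)).div (IsPlot.contDiff (hg n p hp)) fun _ => h0 _)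

lemma dSmooth_mul_sub {f g : X → ℝ} (c : ℝ) (hf : DSmooth f) (hg : DSmooth g) :
    DSmooth (fun x => expNegInvGlue (f x - c * g x)) := fun n p hp =>
  ContDiff.isPlot (expNegInvGlue.contDiff.comp ((IsPlot.contDiff (hf n p hp)).sub
    (contDiff_const.mul (IsPlot.contDiff (hg n p hp)))))

/-- A pointwise-finite sequence of functions can be made locally finite. -/
lemma exists_isLocallyFiniteSeq {ζ : ℕ → X → ℝ} (hζ : ∀ i, DSmooth (ζ i))
    (h0 : ∀ i x, 0 ≤ ζ i x) (hfin : ∀ x, {i | ζ i x ≠ 0}.Finite) (h1 : ∀ x, ∑ᶠ i, ζ i x = 1) :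
    ∃ v : ℕ → X → ℝ, (∀ i, DSmooth (v i)) ∧ IsLocallyFiniteSeq v ∧ (∀ i x, 0 ≤ v i x) ∧
      (∀ x, ∃ i, 0 < v i x) ∧ ∀ i x, ζ i x = 0 → v i x = 0 := by
  have hev : ∀ x, ∃ m, ∀ i ≥ m, ζ i x = 0 := by
    intro x
    obtain ⟨m, hm⟩ := (hfin x).bddAbove
    refine ⟨m + 1, fun i hi => ?_⟩
    by_contra h
    have : i ≤ m := hm h
    omega
  have hsum : ∀ x m, (∀ i ≥ m, ζ i x = 0) → ∑ i ∈ Finset.range m, ζ i x = 1 := fun x m hm => by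
    rw [← finsum_eq_sum_range hm, h1]
  have hle : ∀ x n, ∑ i ∈ Finset.range n, ζ i x ≤ 1 := by
    intro x n
    obtain ⟨m, hm⟩ := hev x
    rw [← hsum x (max m n) fun i hi => hm i (le_trans (le_max_left _ _) hi)]
    exact Finset.sum_le_sum_of_subset_of_nonneg
      (Finset.range_mono (le_max_right _ _)) fun i _ _ => h0 i x
  -- The subtracted term grows once the earlier functions have used up the unit mass. It vanishes at
  -- the first index with `ζ r x ≠ 0`, which gives a positive member of the new sequence at `x`.
  refine ⟨fun r x => expNegInvGlue (ζ r x - r * ∑ i ∈ Finset.range r, ζ i x),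
    fun r => dSmooth_mul_sub r (hζ r) (dSmooth_sum hζ _), fun x => ?_,
    fun r x => expNegInvGlue.nonneg _, fun x => ?_, fun r x hr => ?_⟩
  · obtain ⟨m, hm⟩ := hev x
    refine ⟨_, m + 1, (dSmooth_sum hζ (Finset.range m)).isOpen_preimage_real
      (isOpen_Ioi (a := (1 / 2 : ℝ))), ?_, fun r hr y hy => ?_⟩
    · simp only [mem_preimage, mem_Ioi, hsum x m hm]; norm_num
    -- On the open set where the first `m` functions sum to more than 1/2, later ones are below 1/2.
    -- Starting at `m + 1` ensures that the factor `r` is at least 1.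
    · have hS : 1 / 2 < ∑ i ∈ Finset.range r, ζ i y := lt_of_lt_of_le hy
        (Finset.sum_le_sum_of_subset_of_nonneg (Finset.range_mono (by omega)) fun i _ _ => h0 i y)
      have hr1 : (1 : ℝ) ≤ r := by exact_mod_cast (by omega : 1 ≤ r)
      have := hle y (r + 1)
      rw [Finset.sum_range_succ] at this
      refine expNegInvGlue.zero_of_nonpos ?_
      nlinarith
  · have hex : ∃ r, ζ r x ≠ 0 := by
      by_contra! h
      have := h1 x
      simp [h] at this
    classical
    refine ⟨Nat.find hex, expNegInvGlue.pos_of_pos ?_⟩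
    rw [Finset.sum_eq_zero fun i hi => not_not.1 (Nat.find_min hex (Finset.mem_range.1 hi)),
      mul_zero, sub_zero]
    exact (h0 _ x).lt_of_ne' (Nat.find_spec hex)
  · refine expNegInvGlue.zero_of_nonpos ?_
    rw [hr, zero_sub, neg_nonpos]
    exact mul_nonneg (Nat.cast_nonneg r) (Finset.sum_nonneg fun i _ => h0 i x)

/-- A pointwise-finite countable smooth partition of unity can be replaced by a locally finite one
with smaller closed supports. -/
lemma exists_locallyFinite_partition {ζ : ℕ → X → ℝ} (hζ : ∀ i, DSmooth (ζ i))
    (h0 : ∀ i x, 0 ≤ ζ i x) (hfin : ∀ x, {i | ζ i x ≠ 0}.Finite) (h1 : ∀ x, ∑ᶠ i, ζ i x = 1) :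
    ∃ ρ : ℕ → X → ℝ, (∀ i, DSmooth (ρ i)) ∧ IsLocallyFiniteSeq ρ ∧ (∀ x, ∑ᶠ i, ρ i x = 1) ∧
      ∀ i x, ζ i x = 0 → ∃ N : Set X, IsOpen[dTopology] N ∧ x ∈ N ∧ ∀ y ∈ N, ρ i y = 0 := by
  obtain ⟨v, hv, hvl, hv0, hvpos, hvζ⟩ := exists_isLocallyFiniteSeq hζ h0 hfin h1
  -- The geometric weights make the sum `M` a smooth substitute for the maximum of the `v j`.
  let g : ℕ → X → ℝ := fun j x => (1 / 2) ^ j * v j x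
  have hg : ∀ j, DSmooth (g j) := fun j n p hp =>
    ContDiff.isPlot (contDiff_const.mul (IsPlot.contDiff (hv j n p hp)))
  have hg0 : ∀ j x, 0 ≤ g j x := fun j x => mul_nonneg (by positivity) (hv0 j x)
  have hgl : IsLocallyFiniteSeq g := fun x => by
    obtain ⟨N, m, hN, hx, h⟩ := hvl x
    exact ⟨N, m, hN, hx, fun i hi y hy => by simp [g, h i hi y hy]⟩
  let M : X → ℝ := fun x => ∑ᶠ j, g j x
  have hM : DSmooth M := hgl.dSmooth_finsum hg
  have hMpos : ∀ x, 0 < M x := by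
    intro x
    obtain ⟨N, m, -, hx, h⟩ := hgl x
    obtain ⟨i, hi⟩ := hvpos x
    refine finsum_pos (fun j => hg0 j x) ⟨i, mul_pos (by positivity) hi⟩
      ((Finset.finite_toSet (Finset.range m)).subset fun j hj => ?_)
    simp only [Finset.coe_range, mem_Iio]
    by_contra hm
    exact hj (h j (not_lt.1 hm) x hx)
  -- Were every `v i x` at most `M x / 4`, the geometric series would bound `M x` by `2 · M x / 4`,
  -- contradicting `M x > 0`.
  have hex : ∀ x, ∃ i, 0 < v i x - 1 / 4 * M x := by
    intro x
    obtain ⟨N, m, -, hx, h⟩ := hgl x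
    by_contra! hc
    have hMx : M x = ∑ j ∈ Finset.range m, g j x := finsum_eq_sum_range fun i hi => h i hi x hx
    have hle : M x ≤ (∑ j ∈ Finset.range m, (1 / 2 : ℝ) ^ j) * (1 / 4 * M x) := by
      conv_lhs => rw [hMx]
      rw [Finset.sum_mul]
      exact Finset.sum_le_sum fun j _ =>
        mul_le_mul_of_nonneg_left (by linarith [hc j]) (by positivity)
    have := sum_geometric_two_le m
    nlinarith [hMpos x]
  -- The threshold shrinks supports: where `ζ i x = 0`, also `v i x = 0 < M x / 4`, and this strict
  -- inequality persists on a neighbourhood.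
  let w : ℕ → X → ℝ := fun i x => expNegInvGlue (v i x - 1 / 4 * M x)
  have hw : ∀ i, DSmooth (w i) := fun i => dSmooth_mul_sub _ (hv i) hM
  have hw0 : ∀ i x, 0 ≤ w i x := fun i x => expNegInvGlue.nonneg _
  have hwl : IsLocallyFiniteSeq w := fun x => by
    obtain ⟨N, m, hN, hx, h⟩ := hvl x
    exact ⟨N, m, hN, hx, fun i hi y hy => expNegInvGlue.zero_of_nonpos
      (by rw [h i hi y hy]; linarith [hMpos y])⟩
  let S : X → ℝ := fun x => ∑ᶠ i, w i x
  have hS : DSmooth S := hwl.dSmooth_finsum hw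
  have hSpos : ∀ x, 0 < S x := by
    intro x
    obtain ⟨N, m, -, hx, h⟩ := hwl x
    obtain ⟨i, hi⟩ := hex x
    refine finsum_pos (fun j => hw0 j x) ⟨i, expNegInvGlue.pos_of_pos hi⟩
      ((Finset.finite_toSet (Finset.range m)).subset fun j hj => ?_)
    simp only [Finset.coe_range, mem_Iio]
    by_contra hm
    exact hj (h j (not_lt.1 hm) x hx)
  refine ⟨fun i x => w i x / S x, fun i => dSmooth_div (hw i) hS fun x => (hSpos x).ne',
    fun x => ?_, fun x => ?_, fun i x hi => ?_⟩
  · obtain ⟨N, m, hN, hx, h⟩ := hwl x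
    exact ⟨N, m, hN, hx, fun i hi y hy => by simp [h i hi y hy]⟩
  · obtain ⟨N, m, -, hx, h⟩ := hwl x
    rw [finsum_eq_sum_range fun i hi => show w i x / S x = 0 by rw [h i hi x hx, zero_div],
      ← Finset.sum_div,
      ← finsum_eq_sum_range fun i hi => h i hi x hx]
    exact div_self (hSpos x).ne'
  · refine ⟨_,
      (show DSmooth (fun y => v i y - 1 / 4 * M y) from fun n p hp => ContDiff.isPlot
        ((IsPlot.contDiff (hv i n p hp)).sub (contDiff_const.mul
          (IsPlot.contDiff (hM n p hp))))).isOpen_preimage_real (isOpen_Iio (a := (0 : ℝ))), ?_,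
      fun y hy => ?_⟩
    · simp only [mem_preimage, mem_Iio, hvζ i x hi]
      linarith [hMpos x]
    · have hwy : w i y = 0 := expNegInvGlue.zero_of_nonpos (le_of_lt hy)
      simp only [hwy, zero_div]

end Partition

/-! ### Principal bundles: division and sections -/

section PrincipalBundle

variable {G : Type*} {E : Type*} {X : Type*}
variable [Group G] [DiffeologicalSpace G] [IsDiffeologicalGroup G]
variable [DiffeologicalSpace E] [DiffeologicalSpace X] [MulAction G E] [IsSmoothAction G E]
variable {π : SmoothMap E X}

namespace IsPrincipalBundle

omit [IsDiffeologicalGroup G] in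
-- Triviality over the constant zero-dimensional plot at `x` makes the fibre a free, transitive
-- `G`-orbit.
lemma exists_orbit (hπ : IsPrincipalBundle G π) (x : X) :
    ∃ q : E, (∀ g : G, π (g • q) = x) ∧ (∀ y, π y = x → ∃ g : G, y = g • q) ∧
      ∀ g h : G, g • q = h • q → g = h := by
  obtain ⟨V, -, h0, q, -, -, ψ, hψ⟩ := hπ.locallyTrivial 0 (fun _ => x) isPlot_const 0
  let v : V := ⟨0, h0⟩
  refine ⟨q v, fun g => ?_, fun y hy => ?_, fun g h hgh => ?_⟩
  · have := (ψ.toFun (v, g)).2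
    rw [hψ] at this
    exact this.symm
  · have h1 := ψ.right_inv ⟨(v, y), hy.symm⟩
    have h2 := hψ (ψ.invFun ⟨(v, y), hy.symm⟩).1 (ψ.invFun ⟨(v, y), hy.symm⟩).2
    rw [Prod.mk.eta] at h2
    have h3 := (congrArg Subtype.val h1).symm.trans h2
    rw [Prod.mk.injEq] at h3
    exact ⟨_, by rw [h3.2, ← h3.1]⟩
  · have : ψ.toFun (v, g) = ψ.toFun (v, h) := Subtype.ext (by rw [hψ, hψ, hgh])
    exact congrArg Prod.snd (ψ.injective this)

omit [IsDiffeologicalGroup G] in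
lemma map_smul (hπ : IsPrincipalBundle G π) (g : G) (y : E) : π (g • y) = π y := by
  obtain ⟨q, h1, h2, -⟩ := hπ.exists_orbit (π y)
  obtain ⟨k, hk⟩ := h2 y rfl
  conv_lhs => rw [hk, smul_smul]
  exact h1 _

omit [IsDiffeologicalGroup G] in
lemma exists_smul_eq (hπ : IsPrincipalBundle G π) {y y' : E} (h : π y = π y') :
    ∃ g : G, y' = g • y := by
  obtain ⟨q, -, h2, -⟩ := hπ.exists_orbit (π y)
  obtain ⟨k, hk⟩ := h2 y rfl
  obtain ⟨l, hl⟩ := h2 y' h.symm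
  exact ⟨l * k⁻¹, by rw [hk, hl, smul_smul]; simp⟩

omit [IsDiffeologicalGroup G] in
lemma smul_left_injective (hπ : IsPrincipalBundle G π) {y : E} {g h : G} (hgh : g • y = h • y) :
    g = h := by
  obtain ⟨q, -, h2, h3⟩ := hπ.exists_orbit (π y)
  obtain ⟨k, hk⟩ := h2 y rfl
  rw [hk, smul_smul, smul_smul] at hgh
  exact mul_right_cancel (h3 _ _ hgh)

end IsPrincipalBundle

variable (G) in
open Classical in
/-- The element `g` with `y' = g • y`, for points `y`, `y'` of the same orbit. -/
def fiberDiv (y' y : E) : G := if h : ∃ g : G, y' = g • y then h.choose else 1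

namespace IsPrincipalBundle

omit [IsDiffeologicalGroup G] in
lemma eq_fiberDiv_smul (hπ : IsPrincipalBundle G π) {y y' : E} (h : π y' = π y) :
    y' = fiberDiv G y' y • y := by
  have h := hπ.exists_smul_eq h.symm
  rw [fiberDiv, dif_pos h]
  exact h.choose_spec

omit [IsDiffeologicalGroup G] in
lemma fiberDiv_eq (hπ : IsPrincipalBundle G π) {y y' : E} {g : G} (h : y' = g • y) :
    fiberDiv G y' y = g := by
  have h' : ∃ g : G, y' = g • y := ⟨g, h⟩
  rw [fiberDiv, dif_pos h']
  exact hπ.smul_left_injective (h'.choose_spec.symm.trans h)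

omit [IsDiffeologicalGroup G] in
lemma fiberDiv_smul (hπ : IsPrincipalBundle G π) {y y' : E} (h : π y' = π y) (g : G) :
    fiberDiv G (g • y') y = g * fiberDiv G y' y :=
  hπ.fiberDiv_eq (by rw [mul_smul, ← hπ.eq_fiberDiv_smul h])

/-- Division in the fibres is smooth. -/
lemma dSmoothOn_fiberDiv (hπ : IsPrincipalBundle G π) :
    DSmoothOn (fun a : E × E => fiberDiv G a.1 a.2) {a | π a.1 = π a.2} := by
  intro n p hp hs
  refine isPlot_of_dSmoothAt fun z => ?_
  obtain ⟨V, hV, hz, q, -, -, ψ, hψ⟩ :=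
    hπ.locallyTrivial n (fun y => π (p y).1) (π.smooth n _ hp.1) z
  -- In a trivialisation over the common base plot, both points get smooth coordinates relative to
  -- the same `q`; their quotient is `g k⁻¹`.
  have key : ∀ (c : Euc n → E), IsPlot c → (∀ y, π (p y).1 = π (c y)) →
      ∃ g : V → G, DSmooth g ∧ ∀ y : V, c y = g y • q y := by
    intro c hc hcp
    refine ⟨fun y => (ψ.invFun ⟨(y, c y), hcp y⟩).2, fun m r hr => ?_, fun y => ?_⟩
    · exact (ψ.smooth_invFun m (fun w => ⟨(r w, c (r w)), hcp (r w)⟩)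
        ⟨hr, isPlot_reparam hc (IsPlot.contDiff (show IsPlot (fun w => (r w : Euc n)) from hr))⟩).2
    · have h1 := ψ.right_inv ⟨(y, c y), hcp y⟩
      have h2 := hψ (ψ.invFun ⟨(y, c y), hcp y⟩).1 (ψ.invFun ⟨(y, c y), hcp y⟩).2
      rw [Prod.mk.eta] at h2
      have h3 := (congrArg Subtype.val h1).symm.trans h2
      rw [Prod.mk.injEq] at h3
      conv_lhs => rw [h3.2]
      rw [← h3.1]
  obtain ⟨g, hg, hgp⟩ := key (fun y => (p y).1) hp.1 fun _ => rfl
  obtain ⟨k, hk, hkp⟩ := key (fun y => (p y).2) hp.2 hs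
  refine DSmoothOn.dSmoothAt (s := V) (dSmoothOn_of_restrict ?_) (hV.mem_nhds hz)
  have e : (fun y : V => fiberDiv G (p y).1 (p y).2) = fun y => g y * (k y)⁻¹ := by
    ext y
    refine hπ.fiberDiv_eq ?_
    rw [hgp, hkp, smul_smul, inv_mul_cancel_right]
  rw [e]
  exact IsDiffeologicalGroup.smooth_mul.comp
    (dSmooth_prodMk hg (IsDiffeologicalGroup.smooth_inv.comp hk))

end IsPrincipalBundle

omit [Group G] [DiffeologicalSpace G] [IsDiffeologicalGroup G] [MulAction G E]
  [IsSmoothAction G E] in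
/-- Trivial bundles have smooth sections. -/
lemma IsTrivialOver.exists_section (hsurj : Function.Surjective π) {U : Set X} {F : Type*}
    [DiffeologicalSpace F] (h : IsTrivialOver π U F) :
    ∃ s : X → E, (∀ x, π (s x) = x) ∧ DSmoothOn s U := by
  classical
  rcases U.eq_empty_or_nonempty with rfl | ⟨x₀, hx₀⟩
  -- Over the empty set smoothness is vacuous, since the domain of a plot contains 0.
  · exact ⟨fun x => (hsurj x).choose, fun x => (hsurj x).choose_spec,
      fun n p _ hs => (hs 0).elim⟩
  obtain ⟨φ, hφ⟩ := h
  obtain ⟨y₀, hy₀⟩ := hsurj x₀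
  -- The section has constant fibre coordinate `f₀`, so the fibre `F` of the trivialisation need not
  -- be identified with `G`.
  let f₀ : F := (φ.toFun ⟨(⟨x₀, hx₀⟩, y₀), hy₀.symm⟩).2
  refine ⟨fun x => if h : x ∈ U then (φ.invFun (⟨x, h⟩, f₀)).1.2 else (hsurj x).choose,
    fun x => ?_, fun n p hp hs => ?_⟩
  · dsimp only
    split_ifs with h
    · rw [← (φ.invFun (⟨x, h⟩, f₀)).2, ← hφ]
      exact congrArg (fun a : U × F => (a.1 : X)) (φ.right_inv (⟨x, h⟩, f₀))
    · exact (hsurj x).choose_spec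
  · have e : (fun z => if h : p z ∈ U then (φ.invFun (⟨p z, h⟩, f₀)).1.2
        else (hsurj (p z)).choose) = fun z => (φ.invFun (⟨p z, hs z⟩, f₀)).1.2 := by
      ext z; rw [dif_pos (hs z)]
    rw [e]
    have := φ.smooth_invFun n (fun z => (⟨p z, hs z⟩, f₀)) ⟨hp, isPlot_const⟩
    exact And.right this

/-! ### Connection forms -/

/-- Sections over an open cover, with a subordinate locally finite partition of unity. -/
structure SectionCover (π : SmoothMap E X) where
  /-- The open sets. -/
  opens : ℕ → Set X
  isOpen_opens : ∀ i, IsOpen[dTopology] (opens i)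
  /-- The sections. -/
  sec : ℕ → X → E
  map_sec : ∀ i x, π (sec i x) = x
  smooth_sec : ∀ i, DSmoothOn (sec i) (opens i)
  /-- The partition of unity. -/
  weight : ℕ → X → ℝ
  smooth_weight : ∀ i, DSmooth (weight i)
  locallyFinite : IsLocallyFiniteSeq weight
  sum_weight : ∀ x, ∑ᶠ i, weight i x = 1
  weight_eq_zero : ∀ i x, x ∉ opens i →
    ∃ N : Set X, IsOpen[dTopology] N ∧ x ∈ N ∧ ∀ y ∈ N, weight i y = 0

omit [Group G] [DiffeologicalSpace G] [IsDiffeologicalGroup G] [MulAction G E]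
  [IsSmoothAction G E] in
lemma IsWeaklyDNumerable.nonempty_sectionCover (hsurj : Function.Surjective π)
    (h : IsWeaklyDNumerable π) : Nonempty (SectionCover π) := by
  obtain ⟨F, _, U, ζ, hU, -, htriv, hζ, h0, hfin, h1, hsupp⟩ := h
  obtain ⟨ρ, hρ, hl, hsum, hz⟩ := exists_locallyFinite_partition hζ h0 hfin h1
  choose s hs1 hs2 using fun i => (htriv i).exists_section hsurj
  exact ⟨⟨U, hU, s, hs1, hs2, ρ, hρ, hl, hsum, fun i x hx => hz i x
    (le_antisymm (not_lt.1 fun hlt => hx (hsupp i x hlt)) (h0 i x))⟩⟩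

variable {V : Type*} [NormedAddCommGroup V] [NormedSpace ℝ V] [FiniteDimensional ℝ V]
variable [DiffeologicalSpace V] [IsContDiffCompatible V]

namespace SectionCover

variable (A : SectionCover π)

omit [Group G] [DiffeologicalSpace G] [IsDiffeologicalGroup G] [MulAction G E]
  [IsSmoothAction G E] in
lemma weight_eq_zero_of_notMem {i : ℕ} {x : X} (hx : x ∉ A.opens i) : A.weight i x = 0 := by
  obtain ⟨N, -, h1, h2⟩ := A.weight_eq_zero i x hx
  exact h2 x h1

variable (G) in
/-- The coordinate of `y` in the trivialisation given by the `i`-th section. -/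
def coord (i : ℕ) (y : E) : G := fiberDiv G y (A.sec i (π y))

lemma dSmoothAt_coord (hπ : IsPrincipalBundle G π) {F : V → E} {z : V} (hF : DSmoothAt F z)
    {i : ℕ} (hi : π (F z) ∈ A.opens i) : DSmoothAt (fun y => A.coord G i (F y)) z := by
  have hπF := hF.dSmooth_comp π.smooth
  refine hπ.dSmoothOn_fiberDiv.comp_dSmoothAt (f := fun y => (F y, A.sec i (π (F y))))
    (hF.prodMk ((A.smooth_sec i).comp_dSmoothAt hπF (hπF.eventually_mem (A.isOpen_opens i) hi)))
    (Eventually.of_forall fun y => ?_)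
  exact (A.map_sec i _).symm

omit [IsDiffeologicalGroup G] in
lemma coord_smul (hπ : IsPrincipalBundle G π) (i : ℕ) (g : G) (y : E) :
    A.coord G i (g • y) = g * A.coord G i y := by
  rw [coord, hπ.map_smul]
  exact hπ.fiberDiv_smul (A.map_sec i _).symm g

variable (G) in
/-- The connection form, evaluated on the velocity of `γ` at `t`. -/
def connForm (γ : ℝ → E) (t : ℝ) : IntTangentSpace (1 : G) :=
  ∑ᶠ i, A.weight i (π (γ t)) • logDeriv (fun r => A.coord G i (γ r)) t

omit [IsDiffeologicalGroup G] [IsSmoothAction G E] in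
lemma connForm_congr {γ γ' : ℝ → E} {t : ℝ} (h : γ =ᶠ[𝓝 t] γ') :
    A.connForm G γ t = A.connForm G γ' t := by
  rw [connForm, connForm, h.eq_of_nhds]
  refine finsum_congr fun i => ?_
  exact congrArg _ (logDeriv_congr (h.fun_comp (A.coord G i)))

omit [Group G] [DiffeologicalSpace G] [IsDiffeologicalGroup G] [MulAction G E]
  [IsSmoothAction G E] in
lemma exists_weight_eq_zero (x : X) : ∃ m, ∀ i ≥ m, A.weight i x = 0 := by
  obtain ⟨N, m, -, hx, h⟩ := A.locallyFinite x
  exact ⟨m, fun i hi => h i hi x hx⟩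

/-- Each coordinate is multiplied by `k` on the left, so the product rule gives the law termwise.
The term `logDeriv k t` appears once in total because the weights sum to 1. -/
lemma connForm_smul (hπ : IsPrincipalBundle G π) {γ : ℝ → E} {k : ℝ → G} {t : ℝ}
    (hγ : DSmoothAt γ t) (hk : DSmoothAt k t) :
    A.connForm G (fun r => k r • γ r) t =
      logDeriv k t + adjointMap (k t) (A.connForm G γ t) := by
  obtain ⟨m, hm⟩ := A.exists_weight_eq_zero (π (γ t))
  have hsum := A.sum_weight (π (γ t))
  rw [finsum_eq_sum_range hm] at hsum
  rw [connForm, connForm,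
    finsum_eq_sum_range (m := m) fun i hi => by rw [hπ.map_smul, hm i hi, zero_smul],
    finsum_eq_sum_range (m := m) fun i hi => by rw [hm i hi, zero_smul], map_sum]
  conv_rhs => rw [← one_smul ℝ (logDeriv k t), ← hsum, Finset.sum_smul, ← Finset.sum_add_distrib]
  refine Finset.sum_congr rfl fun i _ => ?_
  rw [hπ.map_smul]
  by_cases hi : π (γ t) ∈ A.opens i
  · simp only [A.coord_smul hπ]
    rw [logDeriv_mul hk (A.dSmoothAt_coord hπ hγ hi), smul_add, _root_.map_smul]
  · simp [A.weight_eq_zero_of_notMem hi]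

/-- Tensoriality in the time direction: the chain rule for each coordinate that has nonzero weight.
-/
lemma connForm_comp (hπ : IsPrincipalBundle G π) {γ : ℝ → E} {f : ℝ → ℝ} {t : ℝ}
    (hγ : DSmoothAt γ (f t)) (hf : DSmoothAt f t) :
    A.connForm G (fun r => γ (f r)) t = deriv f t • A.connForm G γ (f t) := by
  rw [connForm, connForm, smul_finsum]
  refine finsum_congr fun i => ?_
  by_cases hi : π (γ (f t)) ∈ A.opens i
  · rw [logDeriv_comp (k := fun r => A.coord G i (γ r)) (A.dSmoothAt_coord hπ hγ hi) hf,
      smul_comm]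
  · simp [A.weight_eq_zero_of_notMem hi]

/-- The connection form depends smoothly on the time and on parameters. -/
lemma dSmoothAt_connForm (hπ : IsPrincipalBundle G π) {F : V × ℝ → E} {a : V × ℝ}
    (hF : DSmoothAt F a) :
    DSmoothAt (fun b : V × ℝ => A.connForm G (fun r => F (b.1, r)) b.2) a := by
  have hπF := hF.dSmooth_comp π.smooth
  obtain ⟨N, m, hN, ha, h⟩ := A.locallyFinite (π (F a))
  refine DSmoothAt.congr (f := fun b : V × ℝ => ∑ i ∈ Finset.range m,
    A.weight i (π (F b)) • logDeriv (fun r => A.coord G i (F (b.1, r))) b.2)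
    (dSmoothAt_tangentSpace_sum _ fun i _ => ?_) ?_
  · by_cases hi : π (F a) ∈ A.opens i
    · exact ((hπF.dSmooth_comp (A.smooth_weight i)).prodMk (dSmoothAt_logDeriv
        (F := fun b => A.coord G i (F b)) (A.dSmoothAt_coord hπ hF hi))).dSmooth_comp
        (dSmooth_tangentSpace_smul 1)
    -- Here the coordinate may be non-smooth, but its weight vanishes near the point, not just at
    -- it.
    · obtain ⟨N', hN', ha', h'⟩ := A.weight_eq_zero i _ hi
      refine (dSmoothAt_const 0 a).congr ?_
      filter_upwards [hπF.eventually_mem hN' ha'] with b hb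
      rw [h' _ hb, zero_smul]
  · filter_upwards [hπF.eventually_mem hN ha] with b hb
    exact finsum_eq_sum_range fun i hi => by rw [h i hi _ hb, zero_smul]

lemma _root_.DiffBundle.DSmoothAt.connForm (hπ : IsPrincipalBundle G π) {γ : ℝ → E} {t : ℝ}
    (hγ : DSmoothAt γ t) : DSmoothAt (A.connForm G γ) t :=
  (A.dSmoothAt_connForm hπ (F := fun b : ℝ × ℝ => γ b.2) (a := (0, t))
    (DSmoothAt.comp_of_eq hγ (contDiff_snd.dSmoothAt _) rfl)).comp_of_eq
    (g := fun s : ℝ => ((0 : ℝ), s)) ((contDiff_const.prodMk contDiff_id).dSmoothAt t) rfl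

end SectionCover

end PrincipalBundle

/-! ### Paths and their extensions -/

section Paths

variable {Y : Type*} [DiffeologicalSpace Y]

open Classical in
/-- An extension of a map on a nonempty subset of `ℝ`. -/
def extendOfNonempty {D : Set ℝ} (hD : D.Nonempty) (f : D → Y) (t : ℝ) : Y :=
  if h : t ∈ D then f ⟨t, h⟩ else f ⟨hD.some, hD.some_mem⟩

omit [DiffeologicalSpace Y] in
lemma extendOfNonempty_of_mem {D : Set ℝ} (hD : D.Nonempty) (f : D → Y) {t : ℝ} (h : t ∈ D) :
    extendOfNonempty hD f t = f ⟨t, h⟩ := dif_pos h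

lemma dSmoothAt_extendOfNonempty {D : Set ℝ} (hD : D.Nonempty) {f : D → Y} (hf : DSmooth f)
    (hDo : IsOpen D) {t : ℝ} (h : t ∈ D) : DSmoothAt (extendOfNonempty hD f) t := by
  refine DSmoothOn.dSmoothAt (dSmoothOn_of_restrict (s := D) ?_) (hDo.mem_nhds h)
  simpa only [extendOfNonempty_of_mem hD f (Subtype.prop _), Subtype.coe_eta] using hf

namespace LocalPath

lemma ext_of_apply_eq {γ γ' : LocalPath Y} (h : γ.dom = γ'.dom)
    (h' : ∀ t (h₁ : t ∈ γ.dom) (h₂ : t ∈ γ'.dom), γ.toFun ⟨t, h₁⟩ = γ'.toFun ⟨t, h₂⟩) :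
    γ = γ' := by
  obtain ⟨D, h1, h2, h3, f, hf⟩ := γ
  obtain ⟨D', h1', h2', h3', f', hf'⟩ := γ'
  obtain rfl : D = D' := h
  obtain rfl : f = f' := funext fun t => h' t t.2 t.2
  rfl

lemma apply_eq_of_eq {γ γ' : LocalPath Y} (h : γ = γ') {t : ℝ} (h₁ : t ∈ γ.dom)
    (h₂ : t ∈ γ'.dom) : γ.toFun ⟨t, h₁⟩ = γ'.toFun ⟨t, h₂⟩ := by
  subst h; rfl

/-- An extension of a local path to `ℝ`. -/
def extend (γ : LocalPath Y) : ℝ → Y := extendOfNonempty γ.nonempty_dom γ.toFun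

lemma extend_of_mem (γ : LocalPath Y) {t : ℝ} (h : t ∈ γ.dom) : γ.extend t = γ.toFun ⟨t, h⟩ :=
  extendOfNonempty_of_mem _ _ h

lemma dSmoothAt_extend (γ : LocalPath Y) {t : ℝ} (h : t ∈ γ.dom) : DSmoothAt γ.extend t :=
  dSmoothAt_extendOfNonempty _ γ.smooth γ.isOpen_dom h

/-- The restriction of a map that is smooth near all points of an open interval. -/
def ofDSmoothAt (I : Set ℝ) (hIo : IsOpen I) (hI : I.OrdConnected) (hIn : I.Nonempty)
    (u : ℝ → Y) (hu : ∀ t ∈ I, DSmoothAt u t) : LocalPath Y where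
  dom := I
  isOpen_dom := hIo
  ordConnected_dom := hI
  nonempty_dom := hIn
  toFun t := u t
  smooth n p hp := by
    have hp' : IsPlot (fun z => (p z : ℝ)) := hp
    exact isPlot_of_dSmoothAt fun z => (hu _ (p z).2).comp (g := fun z => (p z : ℝ))
      (hp'.dSmooth.dSmoothAt z)

lemma extend_ofDSmoothAt {I : Set ℝ} (hIo : IsOpen I) (hI : I.OrdConnected) (hIn : I.Nonempty)
    {u : ℝ → Y} (hu : ∀ t ∈ I, DSmoothAt u t) {t : ℝ} (ht : t ∈ I) :
    (ofDSmoothAt I hIo hI hIn u hu).extend t = u t :=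
  extend_of_mem (ofDSmoothAt I hIo hI hIn u hu) ht

end LocalPath

/-- The joint map of a plot of local paths is smooth. -/
lemma dSmoothAt_extend_of_isPlot {n : ℕ} {p : Euc n → LocalPath Y} (hp : IsPlot p) {z : Euc n}
    {t : ℝ} (ht : t ∈ (p z).dom) :
    DSmoothAt (fun a : Euc n × ℝ => (p a.1).extend a.2) (z, t) := by
  obtain ⟨U, W, hU, hz, hW, htW, h, hs⟩ := (show IsLocalPathPlot p from hp) z t ht
  refine DSmoothOn.dSmoothAt (s := U ×ˢ W) (fun m r hr hrs => ?_)
    ((hU.prod hW).mem_nhds ⟨hz, htW⟩)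
  have e : (fun y => (p (r y).1).extend (r y).2) =
      fun y => (p (r y).1).toFun ⟨(r y).2, h _ (hrs y).1 (hrs y).2⟩ := by
    ext y; exact LocalPath.extend_of_mem _ _
  rw [e]
  exact hs m (fun y => (⟨(r y).1, (hrs y).1⟩, ⟨(r y).2, (hrs y).2⟩)) hr

end Paths

/-! ### Parallel transport -/

section Transport

variable {G : Type*} {E : Type*} {X : Type*}
variable [Group G] [DiffeologicalSpace G] [IsDiffeologicalGroup G]
variable [DiffeologicalSpace E] [DiffeologicalSpace X] [MulAction G E] [IsSmoothAction G E]
variable {π : SmoothMap E X}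
variable {ex : SmoothMap (Icc (0 : ℝ) 1) (IntTangentSpace (1 : G)) → SmoothMap (Icc (0 : ℝ) 1) G}
variable {I : Set ℝ} {a b : ℝ}

omit [IsDiffeologicalGroup G] in
-- Only the values on the segment enter; smoothness is not needed, so arbitrary extensions of paths
-- beyond their domains do no harm.
lemma solve_congr {η η' : ℝ → IntTangentSpace (1 : G)} (hI : I.OrdConnected)
    (h : ∀ t ∈ I, η t = η' t) (ha : a ∈ I) (hb : b ∈ I) : solve ex η a b = solve ex η' a b := by
  have : (fun s : Icc (0 : ℝ) 1 => (b - a) • η (a + s * (b - a))) =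
      fun s : Icc (0 : ℝ) 1 => (b - a) • η' (a + s * (b - a)) := by
    ext1 s; rw [h _ (segment_mem hI ha hb s.2)]
  simp only [solve, segmentPath, this]

lemma solve_eq_one (hex : IsEvolutionMap ex) (hI : I.OrdConnected)
    {η : ℝ → IntTangentSpace (1 : G)} (h : ∀ t ∈ I, η t = 0) (ha : a ∈ I) (hb : b ∈ I) :
    solve ex η a b = 1 := by
  rw [solve_congr (η' := fun _ => 0) hI h ha hb]
  exact (eq_solve hex hI (fun t _ => dSmoothAt_const _ t) ha (u := fun _ => (1 : G))
    (fun t _ => dSmoothAt_const _ t) (fun t _ => logDeriv_const 1 t) rfl hb).symm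

omit [IsDiffeologicalGroup G] in
lemma DSmoothAt.smul {V : Type*} [TopologicalSpace V] [DiffeologicalSpace V] {k : V → G}
    {γ : V → E} {x : V} (hk : DSmoothAt k x) (hγ : DSmoothAt γ x) :
    DSmoothAt (fun y => k y • γ y) x :=
  (hk.prodMk hγ).dSmooth_comp IsSmoothAction.smooth_smul

variable (A : SectionCover π)

/-- By the product rule and the gauge law, `k u` solves the equation of `kγ`. The right factor `(k
a)⁻¹` normalises the value at `a` and is invisible to the right logarithmic derivative. -/
lemma solve_connForm_smul (hLie : IsDiffeologicalLieGroup G) (hex : IsEvolutionMap ex)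
    (hπ : IsPrincipalBundle G π) (hI : I.OrdConnected) (hIo : IsOpen I) {γ : ℝ → E} {k : ℝ → G}
    (hγ : ∀ t ∈ I, DSmoothAt γ t) (hk : ∀ t ∈ I, DSmoothAt k t) (ha : a ∈ I) (hb : b ∈ I) :
    solve ex (A.connForm G fun r => k r • γ r) a b =
      k b * solve ex (A.connForm G γ) a b * (k a)⁻¹ := by
  have hη : ∀ t ∈ I, DSmoothAt (A.connForm G γ) t := fun t ht => (hγ t ht).connForm A hπ
  have hs : ∀ t ∈ I, DSmoothAt (solve ex (A.connForm G γ) a) t :=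
    fun t ht => dSmoothAt_solve_right hex hI hIo hη ha ht
  refine (eq_solve hex hI (fun t ht => DSmoothAt.connForm A hπ ((hk t ht).smul (hγ t ht))) ha
    (u := fun t => k t * solve ex (A.connForm G γ) a t * (k a)⁻¹)
    (fun t ht => ((hk t ht).mul (hs t ht)).mul (dSmoothAt_const _ _)) (fun t ht => ?_)
    (by simp [solve_self hex hI hη ha]) hb).symm
  rw [logDeriv_mul_const ((hk t ht).mul (hs t ht)), logDeriv_mul (hk t ht) (hs t ht),
    logDeriv_solve hLie hex hI hIo hη ha ht, A.connForm_smul hπ (hγ t ht) (hk t ht)]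

/-- By the chain rules, `u ∘ f` solves the equation of `γ ∘ f`; uniqueness does the rest, and `f`
need not be monotone. -/
lemma solve_connForm_comp (hLie : IsDiffeologicalLieGroup G) (hex : IsEvolutionMap ex)
    (hπ : IsPrincipalBundle G π) (hI : I.OrdConnected) (hIo : IsOpen I) {γ : ℝ → E}
    (hγ : ∀ t ∈ I, DSmoothAt γ t) {J : Set ℝ} (hJ : J.OrdConnected) {f : ℝ → ℝ}
    (hf : ∀ t ∈ J, DSmoothAt f t) (hfI : ∀ t ∈ J, f t ∈ I) (ha : a ∈ J) (hb : b ∈ J) :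
    solve ex (A.connForm G fun r => γ (f r)) a b =
      solve ex (A.connForm G γ) (f a) (f b) := by
  have hη : ∀ t ∈ I, DSmoothAt (A.connForm G γ) t := fun t ht => (hγ t ht).connForm A hπ
  have hs : ∀ t ∈ I, DSmoothAt (solve ex (A.connForm G γ) (f a)) t :=
    fun t ht => dSmoothAt_solve_right hex hI hIo hη (hfI a ha) ht
  refine (eq_solve hex hJ (fun t ht => DSmoothAt.connForm A hπ ((hγ _ (hfI t ht)).comp (hf t ht)))
    ha (u := fun t => solve ex (A.connForm G γ) (f a) (f t))
    (fun t ht => (hs _ (hfI t ht)).comp (hf t ht)) (fun t ht => ?_)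
    (solve_self hex hI hη (hfI a ha)) hb).symm
  rw [logDeriv_comp (hs _ (hfI t ht)) (hf t ht), logDeriv_solve hLie hex hI hIo hη (hfI a ha)
    (hfI t ht), A.connForm_comp hπ (hγ _ (hfI t ht)) (hf t ht)]

lemma dSmoothAt_solve_smul (hex : IsEvolutionMap ex) (hπ : IsPrincipalBundle G π)
    (hI : I.OrdConnected) (hIo : IsOpen I) {γ : ℝ → E} (hγ : ∀ t ∈ I, DSmoothAt γ t) (ha : a ∈ I)
    {t : ℝ} (ht : t ∈ I) :
    DSmoothAt (fun t => (solve ex (A.connForm G γ) a t)⁻¹ • γ t) t :=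
  DSmoothAt.smul (dSmoothAt_solve_right hex hI hIo
    (fun t ht => (hγ t ht).connForm A hπ) ha ht).inv (hγ t ht)

/-- The parallel transport of paths defined by a cover with sections. -/
def transport (hex : IsEvolutionMap ex) (hπ : IsPrincipalBundle G π) (c : TbPaths E) :
    LocalPath E :=
  .ofDSmoothAt c.1.1.dom c.1.1.isOpen_dom c.1.1.ordConnected_dom c.1.1.nonempty_dom
    (fun t => (solve ex (A.connForm G c.1.1.extend) c.1.2 t)⁻¹ • c.1.1.extend t)
    fun _ ht => dSmoothAt_solve_smul A hex hπ c.1.1.ordConnected_dom c.1.1.isOpen_dom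
      (fun _ => c.1.1.dSmoothAt_extend) c.2 ht

lemma transport_apply (hex : IsEvolutionMap ex) (hπ : IsPrincipalBundle G π) (γ : LocalPath E)
    (t₀ : γ.dom) {t : ℝ} (ht : t ∈ γ.dom) : (transport A hex hπ (.mk γ t₀)).toFun ⟨t, ht⟩ =
      (solve ex (A.connForm G γ.extend) t₀ t)⁻¹ • γ.toFun ⟨t, ht⟩ := by
  rw [← γ.extend_of_mem ht]; rfl

lemma dSmooth_transport (hex : IsEvolutionMap ex) (hπ : IsPrincipalBundle G π) :
    DSmooth (transport A hex hπ) := by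
  intro n P hP z t ht
  have hP1 : IsPlot (fun z => (P z).1.1) := hP.1
  have hP2 : IsPlot (fun z => (P z).1.2) := hP.2
  obtain ⟨U, W, hU, hz, hW, htW, h, -⟩ := (show IsLocalPathPlot _ from hP1) z t ht
  -- Transport keeps the domain, so the neighbourhoods of the given plot serve again; only joint
  -- smoothness of `u⁻¹ γ` remains.
  refine ⟨U, W, hU, hz, hW, htW, h, fun m w hw => isPlot_of_dSmoothAt fun y => ?_⟩
  have hw1 : IsPlot (fun y => ((w y).1 : Euc n)) := hw.1
  have hw2 : IsPlot (fun y => ((w y).2 : ℝ)) := hw.2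
  have hF : ∀ y r, r ∈ (P (w y).1).1.1.dom →
      DSmoothAt (fun b : Euc m × ℝ => (P (w b.1).1).1.1.extend b.2) (y, r) := by
    intro y r hr
    refine (dSmoothAt_extend_of_isPlot hP1 hr).comp_of_eq
      (g := fun b : Euc m × ℝ => (((w b.1).1 : Euc n), b.2)) (DSmoothAt.prodMk ?_ ?_) rfl
    · exact (hw1.dSmooth.comp dSmooth_fst).dSmoothAt _
    · exact dSmooth_snd.dSmoothAt _
  have hmem : ∀ y, ((w y).2 : ℝ) ∈ (P (w y).1).1.1.dom := fun y => h _ (w y).1.2 (w y).2.2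
  refine DSmoothAt.smul (DSmoothAt.inv (dSmoothAt_solve hex.smooth
    (η := fun y => A.connForm G (P (w y).1).1.1.extend) (a := fun y => (P (w y).1).1.2)
    (b := fun y => ((w y).2 : ℝ)) ?_ (hw2.dSmooth.dSmoothAt y)
    (Eventually.of_forall fun y s hs => ?_))) ?_
  · exact (hP2.dSmooth.comp hw1.dSmooth).dSmoothAt y
  · exact A.dSmoothAt_connForm hπ (hF y _ (segment_mem (P (w y).1).1.1.ordConnected_dom
      (P (w y).1).2 (hmem y) hs))
  · exact (hF y _ (hmem y)).comp_of_eq (g := fun y => (y, ((w y).2 : ℝ)))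
      ((dSmooth_id'.dSmoothAt y).prodMk (hw2.dSmooth.dSmoothAt y)) rfl

/-- Parallel transport is a diffeological connection. -/
lemma isDiffeologicalConnection_transport (hLie : IsDiffeologicalLieGroup G)
    (hex : IsEvolutionMap ex) (hπ : IsPrincipalBundle G π) :
    IsDiffeologicalConnection G π (transport A hex hπ) where
  smooth := dSmooth_transport A hex hπ
  dom_eq _ _ := rfl
  map_eq γ t₀ := LocalPath.ext_of_apply_eq rfl fun t h₁ h₂ => by
    refine (congrArg π (transport_apply A hex hπ γ t₀ h₁)).trans ?_
    rw [hπ.map_smul]; rfl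
  base γ t₀ := ⟨t₀.2, by
    rw [transport_apply A hex hπ γ t₀ t₀.2, solve_self hex γ.ordConnected_dom
      (fun t ht => (γ.dSmoothAt_extend ht).connForm A hπ) t₀.2, inv_one, one_smul]⟩
  smul γ t₀ k := LocalPath.ext_of_apply_eq rfl fun t h₁ h₂ => by
    let k' := extendOfNonempty γ.nonempty_dom k.toFun
    have hk' : ∀ r (hr : r ∈ γ.dom), k' r = k ⟨r, hr⟩ := fun r hr =>
      extendOfNonempty_of_mem _ _ hr
    have ht : t ∈ γ.dom := h₁
    -- With this solution, `(k u k(t₀)⁻¹)⁻¹ k γ = k(t₀) u⁻¹ γ`: the varying factor cancels.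
    have e : solve ex (A.connForm G (γ.smul k).extend) t₀ t =
        k' t * solve ex (A.connForm G γ.extend) t₀ t * (k' t₀)⁻¹ := by
      rw [← solve_connForm_smul A hLie hex hπ γ.ordConnected_dom γ.isOpen_dom
        (fun r hr => γ.dSmoothAt_extend hr)
        (fun r hr => dSmoothAt_extendOfNonempty _ k.smooth γ.isOpen_dom hr) t₀.2 ht]
      refine solve_congr γ.ordConnected_dom (fun r hr => A.connForm_congr ?_) t₀.2 ht
      filter_upwards [γ.isOpen_dom.mem_nhds hr] with s hs
      rw [LocalPath.extend_of_mem (γ.smul k) hs, γ.extend_of_mem hs]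
      exact congrArg (· • γ.toFun ⟨s, hs⟩) (hk' s hs).symm
    refine (transport_apply A hex hπ (γ.smul k) t₀ h₁).trans ?_
    refine Eq.trans ?_ (congrArg (k t₀ • ·) (transport_apply A hex hπ γ t₀ ht)).symm
    rw [e, hk' t ht, hk' t₀ t₀.2]
    show _ • k ⟨t, ht⟩ • γ.toFun ⟨t, ht⟩ = _
    simp only [smul_smul]
    congr 1
    group
  comp γ f hf s := LocalPath.ext_of_apply_eq rfl fun t h₁ h₂ => by
    have ht : t ∈ f.dom := h₁
    have hm : ∀ r ∈ f.dom, f.extend r ∈ γ.dom := fun r hr => by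
      rw [f.extend_of_mem hr]; exact hf _
    have e : solve ex (A.connForm G (γ.comp f hf).extend) s t =
        solve ex (A.connForm G γ.extend) (f.extend s) (f.extend t) := by
      rw [← solve_connForm_comp A hLie hex hπ γ.ordConnected_dom γ.isOpen_dom
        (fun r hr => γ.dSmoothAt_extend hr) f.ordConnected_dom
        (fun r hr => f.dSmoothAt_extend hr) hm s.2 ht]
      refine solve_congr f.ordConnected_dom (fun r hr => A.connForm_congr ?_) s.2 ht
      filter_upwards [f.isOpen_dom.mem_nhds hr] with r' hr'
      rw [LocalPath.extend_of_mem (γ.comp f hf) hr', γ.extend_of_mem (hm r' hr')]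
      simp only [f.extend_of_mem hr']
      rfl
    refine (transport_apply A hex hπ (γ.comp f hf) s h₁).trans ?_
    refine Eq.trans ?_ (transport_apply A hex hπ γ ⟨f.toFun s, hf s⟩ (hf ⟨t, ht⟩)).symm
    rw [e, f.extend_of_mem ht, f.extend_of_mem s.2]
    rfl
  proj γ t₀ := LocalPath.ext_of_apply_eq rfl fun t h₁ h₂ => by
    have ht : t ∈ γ.dom := h₁
    have hη : ∀ r ∈ γ.dom, DSmoothAt (A.connForm G γ.extend) r :=
      fun r hr => (γ.dSmoothAt_extend hr).connForm A hπ
    refine (transport_apply A hex hπ (transport A hex hπ (.mk γ t₀)) ⟨t₀, t₀.2⟩ ht).trans ?_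
    -- The gauge rule with `k = u⁻¹` shows that a transported path has trivial solution.
    have e : solve ex (A.connForm G (transport A hex hπ (.mk γ t₀)).extend) t₀ t = 1 := by
      have e1 := solve_connForm_smul A hLie hex hπ γ.ordConnected_dom γ.isOpen_dom
        (fun r hr => γ.dSmoothAt_extend hr) (k := fun r => (solve ex (A.connForm G γ.extend) t₀ r)⁻¹)
        (fun r hr => (dSmoothAt_solve_right hex γ.ordConnected_dom γ.isOpen_dom hη t₀.2 hr).inv)
        t₀.2 ht
      rw [inv_mul_cancel, solve_self hex γ.ordConnected_dom hη t₀.2, inv_one, inv_one,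
        mul_one] at e1
      rw [← e1]
      refine solve_congr γ.ordConnected_dom (fun r hr => A.connForm_congr ?_) t₀.2 ht
      filter_upwards [γ.isOpen_dom.mem_nhds hr] with s hs
      exact LocalPath.extend_ofDSmoothAt _ _ _ _ hs
    rw [e, inv_one, one_smul]

end Transport

/-! ### Horizontal lifts -/

section Lifts

variable {G : Type*} {E : Type*} {X : Type*}
variable [Group G] [DiffeologicalSpace G] [IsDiffeologicalGroup G]
variable [DiffeologicalSpace E] [DiffeologicalSpace X] [MulAction G E] [IsSmoothAction G E]
variable {π : SmoothMap E X}
variable {ex : SmoothMap (Icc (0 : ℝ) 1) (IntTangentSpace (1 : G)) → SmoothMap (Icc (0 : ℝ) 1) G}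

variable (G) in
/-- `γ` is a horizontal lift of `c` over `J`. -/
def IsHorizontalLift (A : SectionCover π) (c : ℝ → X) (J : Set ℝ) (γ : ℝ → E) : Prop :=
  ∀ t ∈ J, DSmoothAt γ t ∧ π (γ t) = c t ∧ A.connForm G γ t = 0

namespace IsHorizontalLift

variable {A : SectionCover π} {c : ℝ → X} {J : Set ℝ} {γ γ' : ℝ → E}

lemma smul (hπ : IsPrincipalBundle G π) (h : IsHorizontalLift G A c J γ) (g : G) :
    IsHorizontalLift G A c J (fun r => g • γ r) := fun t ht => by
  obtain ⟨h1, h2, h3⟩ := h t ht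
  refine ⟨(dSmoothAt_const g t).smul h1, (hπ.map_smul g _).trans h2, ?_⟩
  rw [A.connForm_smul hπ h1 (dSmoothAt_const g t), logDeriv_const, h3, map_zero, add_zero]

omit [IsDiffeologicalGroup G] [IsSmoothAction G E] in
lemma congr (h : IsHorizontalLift G A c J γ) (hJ : IsOpen J) (he : EqOn γ' γ J) :
    IsHorizontalLift G A c J γ' := fun t ht => by
  obtain ⟨h1, h2, h3⟩ := h t ht
  have : γ' =ᶠ[𝓝 t] γ := he.eventuallyEq_of_mem (hJ.mem_nhds ht)
  exact ⟨h1.congr this, by rw [he ht, h2], by rw [A.connForm_congr this, h3]⟩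

omit [IsDiffeologicalGroup G] [IsSmoothAction G E] in
lemma mono (h : IsHorizontalLift G A c J γ) {J' : Set ℝ} (hJ : J' ⊆ J) :
    IsHorizontalLift G A c J' γ := fun t ht => h t (hJ ht)

/-- Horizontal lifts are unique up to the action of a constant. -/
lemma exists_eq_smul (hex : IsEvolutionMap ex) (hπ : IsPrincipalBundle G π) (hJ : J.OrdConnected)
    (hJo : IsOpen J) (h : IsHorizontalLift G A c J γ) (h' : IsHorizontalLift G A c J γ') {a : ℝ}
    (ha : a ∈ J) : ∃ g : G, ∀ t ∈ J, γ' t = g • γ t := by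
  let k : ℝ → G := fun t => fiberDiv G (γ' t) (γ t)
  have hpr : ∀ t ∈ J, π (γ' t) = π (γ t) := fun t ht => by rw [(h t ht).2.1, (h' t ht).2.1]
  have hk : ∀ t ∈ J, DSmoothAt k t := fun t ht =>
    hπ.dSmoothOn_fiberDiv.comp_dSmoothAt (f := fun t => (γ' t, γ t))
      ((h' t ht).1.prodMk (h t ht).1) (by filter_upwards [hJo.mem_nhds ht] with r hr using hpr r hr)
  have heq : EqOn γ' (fun t => k t • γ t) J := fun t ht => hπ.eq_fiberDiv_smul (hpr t ht)
  -- The gauge law for `γ' = kγ` reads `0 = δk + Ad_k 0`.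
  have hk0 : ∀ t ∈ J, logDeriv k t = 0 := fun t ht => by
    have h1 := A.connForm_smul hπ (h t ht).1 (hk t ht)
    rw [← A.connForm_congr (heq.eventuallyEq_of_mem (hJo.mem_nhds ht)), (h' t ht).2.2,
      (h t ht).2.2, map_zero, add_zero] at h1
    exact h1.symm
  exact ⟨k a, fun t ht => by
    rw [← eq_of_logDeriv_eq_zero hex hJ hk hk0 ha ht]; exact heq ht⟩

lemma eqOn (hex : IsEvolutionMap ex) (hπ : IsPrincipalBundle G π) (hJ : J.OrdConnected)
    (hJo : IsOpen J) (h : IsHorizontalLift G A c J γ) (h' : IsHorizontalLift G A c J γ') {a : ℝ}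
    (ha : a ∈ J) (haa : γ' a = γ a) : EqOn γ' γ J := by
  obtain ⟨g, hg⟩ := exists_eq_smul hex hπ hJ hJo h h' ha
  have : g = 1 := hπ.smul_left_injective (y := γ a) (by rw [← hg a ha, haa, one_smul])
  intro t ht
  rw [hg t ht, this, one_smul]

/-- Horizontal lifts exist locally. -/
lemma exists_local (hLie : IsDiffeologicalLieGroup G) (hex : IsEvolutionMap ex)
    (hπ : IsPrincipalBundle G π) (A : SectionCover π) {t : ℝ} (hc : DSmoothAt c t) {N : Set ℝ}
    (hN : N ∈ 𝓝 t) : ∃ (J : Set ℝ) (γ : ℝ → E), IsOpen J ∧ J.OrdConnected ∧ t ∈ J ∧ J ⊆ N ∧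
      IsHorizontalLift G A c J γ := by
  classical
  obtain ⟨q, hq, hcq⟩ := hc
  let ι : ℝ → Euc 1 := fun r => EuclideanSpace.single 0 r
  have hι : ContDiff ℝ ∞ ι := by
    refine contDiff_euclidean.2 fun i => ?_
    have : (fun r => ι r i) = fun r => r := by
      ext r; simp [ι, Subsingleton.elim i 0]
    rw [this]; exact contDiff_id
  have hp : IsPlot (fun z : Euc 1 => q (z 0)) := IsPlot.dSmooth_comp (p := fun z : Euc 1 => z 0)
    (ContDiff.isPlot (contDiff_piLp_apply (p := 2))) hq
  -- The curve, read as a one-dimensional plot, has a smooth local lift `σ`, which is then made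
  -- horizontal by the factor `u⁻¹`.
  obtain ⟨V, hV, ht, σ, hσ, hσq, -⟩ := hπ.locallyTrivial 1 _ hp (ι t)
  have hmem : N ∩ {r | c r = q r} ∩ ι ⁻¹' V ∈ 𝓝 t :=
    inter_mem (inter_mem hN hcq) ((hV.preimage hι.continuous).mem_nhds ht)
  obtain ⟨ε, hε, hεJ⟩ := Metric.mem_nhds_iff.1 hmem
  rw [Real.ball_eq_Ioo] at hεJ
  set J := Ioo (t - ε) (t + ε) with hJdef
  have htJ : t ∈ J := ⟨by linarith, by linarith⟩
  have hJo : IsOpen J := isOpen_Ioo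
  have hJ : J.OrdConnected := ordConnected_Ioo
  let σ' : Euc 1 → E := fun z => if h : z ∈ V then σ ⟨z, h⟩ else σ ⟨ι t, ht⟩
  have hσ' : ∀ r ∈ J, DSmoothAt (fun r => σ' (ι r)) r := fun r hr => by
    refine DSmoothAt.comp (f := σ') (DSmoothOn.dSmoothAt (dSmoothOn_of_restrict (s := V) ?_)
      (hV.mem_nhds (hεJ hr).2)) (hι.dSmoothAt r)
    simpa [σ'] using hσ
  have hη : ∀ r ∈ J, DSmoothAt (A.connForm G fun r => σ' (ι r)) r :=
    fun r hr => (hσ' r hr).connForm A hπ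
  have hs : ∀ r ∈ J, DSmoothAt (solve ex (A.connForm G fun r => σ' (ι r)) t) r :=
    fun r hr => dSmoothAt_solve_right hex hJ hJo hη htJ hr
  refine ⟨J, _, hJo, hJ, htJ, fun r hr => (hεJ hr).1.1, fun r hr =>
    ⟨dSmoothAt_solve_smul A hex hπ hJ hJo hσ' htJ hr, ?_, ?_⟩⟩
  · have e : σ' (ι r) = σ ⟨ι r, (hεJ hr).2⟩ := dif_pos _
    rw [hπ.map_smul, e, hσq, show c r = q r from (hεJ hr).1.2]
    simp [ι]
  -- The gauge law yields `δ(u⁻¹) + Ad_{u⁻¹} δu`, which is `δ(u⁻¹ u) = 0`.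
  · rw [A.connForm_smul hπ (hσ' r hr) (hs r hr).inv, ← logDeriv_solve hLie hex hJ hJo hη htJ hr,
      ← logDeriv_mul (hs r hr).inv (hs r hr)]
    simp only [inv_mul_cancel]
    exact logDeriv_const _ _

/-- Horizontal lifts over overlapping intervals can be glued. -/
lemma exists_union (hex : IsEvolutionMap ex) (hπ : IsPrincipalBundle G π) {J' : Set ℝ}
    (hJ : J.OrdConnected) (hJo : IsOpen J) (hJ' : J'.OrdConnected) (hJo' : IsOpen J')
    (h : IsHorizontalLift G A c J γ) (h' : IsHorizontalLift G A c J' γ') (hn : (J ∩ J').Nonempty) :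
    ∃ δ : ℝ → E, IsHorizontalLift G A c (J ∪ J') δ ∧ EqOn δ γ J := by
  classical
  obtain ⟨a, ha⟩ := hn
  obtain ⟨g, hg⟩ := exists_eq_smul hex hπ (hJ.inter hJ') (hJo.inter hJo')
    (h'.mono inter_subset_right) (h.mono inter_subset_left) ha
  let δ : ℝ → E := fun r => if r ∈ J then γ r else g • γ' r
  have e1 : EqOn δ γ J := fun r hr => if_pos hr
  have e2 : EqOn δ (fun r => g • γ' r) J' := fun r hr => by
    by_cases hrJ : r ∈ J
    · rw [e1 hrJ]; exact hg r ⟨hrJ, hr⟩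
    · exact if_neg hrJ
  exact ⟨δ, fun r hr => hr.elim (h.congr hJo e1 r) ((h'.smul hπ g).congr hJo' e2 r), e1⟩

/-- Horizontal lifts exist over open intervals. -/
lemma exists_lift (hLie : IsDiffeologicalLieGroup G) (hex : IsEvolutionMap ex)
    (hπ : IsPrincipalBundle G π) (A : SectionCover π) {I : Set ℝ} (hI : I.OrdConnected)
    (hIo : IsOpen I) (hc : ∀ t ∈ I, DSmoothAt c t) {t₀ : ℝ} (ht₀ : t₀ ∈ I) {y : E}
    (hy : π y = c t₀) : ∃ γ : ℝ → E, IsHorizontalLift G A c I γ ∧ γ t₀ = y := by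
  -- Times reached by some horizontal lift through `y`. This set is open and relatively closed in
  -- `I`, by local existence and gluing, so it contains the connected `I`.
  let S : Set ℝ := {t | ∃ (J : Set ℝ) (γ : ℝ → E), IsOpen J ∧ J.OrdConnected ∧ t₀ ∈ J ∧ t ∈ J ∧
    IsHorizontalLift G A c J γ ∧ γ t₀ = y}
  have hS₀ : t₀ ∈ S := by
    obtain ⟨J, γ, hJo, hJ, htJ, -, hγ⟩ := exists_local hLie hex hπ A (hc t₀ ht₀) univ_mem
    obtain ⟨g, hg⟩ := hπ.exists_smul_eq (y := γ t₀) (y' := y) (by rw [(hγ t₀ htJ).2.1, hy])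
    exact ⟨J, _, hJo, hJ, htJ, htJ, hγ.smul hπ g, hg.symm⟩
  have hSo : IsOpen S := by
    refine isOpen_iff_mem_nhds.2 fun t ht => ?_
    obtain ⟨J, γ, hJo, hJ, h0, htJ, hγ, hγ0⟩ := ht
    exact mem_of_superset (hJo.mem_nhds htJ) fun r hr => ⟨J, γ, hJo, hJ, h0, hr, hγ, hγ0⟩
  have hSc : closure S ∩ I ⊆ S := by
    rintro t ⟨htS, htI⟩
    obtain ⟨J', γ', hJo', hJ', htJ', -, hγ'⟩ := exists_local hLie hex hπ A (hc t htI) univ_mem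
    obtain ⟨r, hrJ', J, γ, hJo, hJ, h0, hrJ, hγ, hγ0⟩ :=
      mem_closure_iff_nhds.1 htS J' (hJo'.mem_nhds htJ')
    obtain ⟨δ, hδ, hδγ⟩ := exists_union hex hπ hJ hJo hJ' hJo' hγ hγ' ⟨r, hrJ, hrJ'⟩
    refine ⟨J ∪ J', δ, hJo.union hJo', ?_, Or.inl h0, Or.inr htJ', hδ, by rw [hδγ h0, hγ0]⟩
    exact (IsPreconnected.union r hrJ hrJ' hJ.isPreconnected hJ'.isPreconnected).ordConnected
  have hIS : I ⊆ S := hI.isPreconnected.subset_of_closure_inter_subset hSo ⟨t₀, ht₀, hS₀⟩ hSc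
  have : Nonempty E := ⟨y⟩
  choose! J γ hJo hJ h0 htJ hγ hγ0 using fun t (ht : t ∈ I) => hIS ht
  -- The chosen lifts all pass through `y` at `t₀`, so they agree on overlaps, and the diagonal `t ↦
  -- γ t t` is locally one of them.
  have hloc : ∀ t ∈ I, ∀ r ∈ I, r ∈ J t → γ r r = γ t r := fun t ht r hr hrt =>
    eqOn hex hπ ((hJ t ht).inter (hJ r hr)) ((hJo t ht).inter (hJo r hr))
      ((hγ t ht).mono inter_subset_left) ((hγ r hr).mono inter_subset_right)
      (a := t₀) ⟨h0 t ht, h0 r hr⟩ (by rw [hγ0 t ht, hγ0 r hr]) ⟨hrt, htJ r hr⟩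
  refine ⟨fun t => γ t t, fun t ht => ?_, hγ0 t₀ ht₀⟩
  exact (((hγ t ht).mono inter_subset_left).congr (J := J t ∩ I) ((hJo t ht).inter hIo)
    fun r hr => hloc t ht r hr.2 hr.1) t ⟨htJ t ht, ht⟩

end IsHorizontalLift

/-- A connection for which horizontal lifts exist and are unique. -/
lemma exists_horizontal_lift (hLie : IsDiffeologicalLieGroup G) (hex : IsEvolutionMap ex)
    (hπ : IsPrincipalBundle G π) (A : SectionCover π) (c : LocalPath X) (t₀ : c.dom) (y : E)
    (hy : π y = c.toFun t₀) : ∃ γ : LocalPath E,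
      (γ.map π = c ∧ γ.PassesThrough t₀ y ∧ IsHorizontal (transport A hex hπ) γ) ∧
      ∀ γ' : LocalPath E, γ'.map π = c → γ'.PassesThrough t₀ y →
        IsHorizontalAt (transport A hex hπ) γ' t₀ → γ' = γ := by
  obtain ⟨u, hu, hu0⟩ := IsHorizontalLift.exists_lift hLie hex hπ A c.ordConnected_dom c.isOpen_dom
    (fun t ht => c.dSmoothAt_extend ht) t₀.2 (hy.trans (c.extend_of_mem t₀.2).symm)
  let γ : LocalPath E := .ofDSmoothAt c.dom c.isOpen_dom c.ordConnected_dom c.nonempty_dom u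
    fun t ht => (hu t ht).1
  have hγu : EqOn γ.extend u c.dom := fun t ht => LocalPath.extend_ofDSmoothAt _ _ _ _ ht
  have hγ : IsHorizontalLift G A c.extend c.dom γ.extend := hu.congr c.isOpen_dom hγu
  have hγc : γ.map π = c := LocalPath.ext_of_apply_eq rfl fun t _ ht =>
    (hu t ht).2.1.trans (c.extend_of_mem ht)
  have hhor : IsHorizontal (transport A hex hπ) γ := fun t ht =>
    ⟨ht, LocalPath.ext_of_apply_eq rfl fun r _ hr => by
      rw [transport_apply A hex hπ γ ⟨t, ht⟩ hr, solve_eq_one hex c.ordConnected_dom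
        (fun s hs => (hγ s hs).2.2) ht hr, inv_one, one_smul]⟩
  refine ⟨γ, ⟨hγc, ⟨t₀.2, hu0⟩, hhor⟩, fun γ' hγ'c hγ'y hγ'h => ?_⟩
  have hdom : γ'.dom = γ.dom := congrArg (fun δ : LocalPath X => δ.dom) hγ'c
  obtain ⟨h0, hγ'0⟩ := hγ'y
  have hm : ∀ t ∈ γ.dom, t ∈ γ'.dom := fun t ht => hdom.symm.subset ht
  have hpr : ∀ t (ht : t ∈ γ.dom), π (γ'.toFun ⟨t, hm t ht⟩) = π (γ.toFun ⟨t, ht⟩) :=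
    fun t ht => LocalPath.apply_eq_of_eq (hγ'c.trans hγc.symm) (γ := γ'.map π) (γ' := γ.map π)
      (hm t ht) ht
  -- Any competing lift is `k • γ` with `k(t₀) = 1`. Axiom 3 then gives `θ(γ', t₀) = θ(γ, t₀) = γ`,
  -- so horizontality of `γ'` at the single time `t₀` suffices.
  let k : SmoothMap γ.dom G := ⟨fun t => fiberDiv G (γ'.toFun ⟨t, hm t t.2⟩) (γ.toFun t),
    hπ.dSmoothOn_fiberDiv.comp_dSmooth (g := fun t : γ.dom => (γ'.toFun ⟨t, hm t t.2⟩, γ.toFun t))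
      (dSmooth_prodMk (γ'.smooth.comp (f := fun t : γ.dom => (⟨t, hm t t.2⟩ : γ'.dom))
        fun n p hp => hp) γ.smooth) fun t => hpr t t.2⟩
  have hγ'k : γ' = γ.smul k := LocalPath.ext_of_apply_eq hdom fun t h₁ h₂ =>
    hπ.eq_fiberDiv_smul (hpr t h₂)
  have hk1 : k t₀ = 1 := hπ.fiberDiv_eq (by rw [one_smul, hγ'0]; exact hu0.symm)
  have hcon := (isDiffeologicalConnection_transport A hLie hex hπ).smul γ t₀ k
  obtain ⟨_, h1⟩ := hhor t₀ t₀.2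
  rw [hγ'k] at hγ'h
  obtain ⟨_, h2⟩ := hγ'h
  refine hγ'k.trans (h2.symm.trans (hcon.trans ?_))
  refine Eq.trans (congrArg (LocalPath.constSMul (k t₀)) h1) ?_
  refine LocalPath.ext_of_apply_eq rfl fun t h₁ h₂ => ?_
  show k t₀ • γ.toFun ⟨t, h₂⟩ = _
  rw [hk1, one_smul]

end Lifts

end DiffBundle

end

theorem theoremt {G : Type*} {E : Type*} {X : Type*}
    [Group G] [DiffeologicalSpace G] [IsDiffeologicalGroup G]
    [DiffeologicalSpace E] [DiffeologicalSpace X] [MulAction G E] [IsSmoothAction G E]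
    (hLie : IsDiffeologicalLieGroup G) (hreg : IsRegularGroup G)
    (hT2 : IsDHausdorff X) (hpara : IsSmoothlyParacompact X)
    (π : SmoothMap E X) (hπ : IsPrincipalBundle G π) (hnum : IsWeaklyDNumerable π) :
    ∃ θ : TbPaths E → LocalPath E,
      IsDiffeologicalConnection G π θ ∧
      ∀ (c : LocalPath X) (t₀ : c.dom) (y : E), π y = c.toFun t₀ →
        ∃ γ : LocalPath E,
          (γ.map π = c ∧ γ.PassesThrough t₀ y ∧ IsHorizontal θ γ) ∧
          ∀ γ' : LocalPath E, γ'.map π = c → γ'.PassesThrough t₀ y →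
            IsHorizontalAt θ γ' t₀ → γ' = γ := by
  obtain ⟨ex, hsm, hev⟩ := hreg
  have hex : IsEvolutionMap ex :=
    ⟨hsm, fun ξ => (hev ξ).1, fun ξ g hg => (hev ξ).2 g hg⟩
  obtain ⟨A⟩ := hnum.nonempty_sectionCover hπ.surjective
  exact ⟨transport A hex hπ, isDiffeologicalConnection_transport A hLie hex hπ,
    fun c t₀ y hy => exists_horizontal_lift hLie hex hπ A c t₀ y hy⟩
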